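/- Let $n\ge 0$. Write $\mathcal D(U)$ for the real test functions on an open set $U\subseteq\mathbb R^n$ and $\mathcal D'(U)$ for the (complex-valued) distributions on $U$. For a scale invariant open set $U$ ($\lambda U=U$ for all $\lambda>0$) and $t\in\mathcal D'(U)$, let $t_\lambda(x)=t(\lambda x)$, i.e. $\langle t_\lambda,f\rangle=\lambda^{-n}\langle t,f(\cdot/\lambda)\rangle$, and let the scaling degree be $\mathrm{sd}(t)=\inf\{\delta\in\mathbb R:\lim_{\lambda\to0^+}\lambda^\delta\langle t_\lambda,f\rangle=0\ \text{for all } f\in\mathcal D(U)\}\in[-\infty,+\infty]$. For $l\in[-\infty,\infty)$ let $\mathcal D_l(\mathbb R^n)$ be the space of the $f\in\mathcal D(\mathbb R^n)$ with $(\partial^\alpha f)(0)=0$ for all multi-indices $|\alpha|\le l$, with the induced topology, and let $\mathcal D'_l(\mathbb R^n)$ be its dual; the scaling degree of an element of $\mathcal D'_l(\mathbb R^n)$ is defined by the same formula, with test functions in $\mathcal D_l(\mathbb R^n)$. Let $\tilde t\in\mathcal D'(\mathbb R^n\setminus\{0\})$ with $\mathrm{sd}(\tilde t)<\infty$, put $l=\mathrm{sd}(\tilde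 t)-n$, and let $\bar t\in\mathcal D'_l(\mathbb R^n)$ be the unique extension of $\tilde t$ to $\mathcal D_l(\mathbb R^n)$ with $\mathrm{sd}(\bar t)=\mathrm{sd}(\tilde t)$. An analytic regularization of $\tilde t$ is a family $\{t^\zeta\}_{\zeta\in\Omega\setminus\{0\}}\subset\mathcal D'(\mathbb R^n)$, with $\Omega\subset\mathbb C$ a neighbourhood of $0$, such that $\lim_{\zeta\to0}\langle t^\zeta,g\rangle=\langle\bar t,g\rangle$ for all $g\in\mathcal D_l(\mathbb R^n)$, and such that for every $f\in\mathcal D(\mathbb R^n)$ the map $\zeta\mapsto\langle t^\zeta,f\rangle$ is analytic on $\Omega\setminus\{0\}$ with at most a pole of finite order at $0$. For a function $F$ that is meromorphic at $0$, let $\mathrm{pp}(F)$ be the principal part (the terms with negative powers of $\zeta$) of its Laurent series at $0$, and $\mathrm{rp}(F)=F-\mathrm{pp}(F)$. **Corollary (Minimal Subtraction).** Let $\{t^\zeta\}$ be any analytic regularization of $\tilde t$. Then: 1. For every $f\in\mathcal D(\mathbb R^n)$ the limit $\langle t^{\mathrm{MS}},f\rangle:=\lim_{\zeta\to0}\mathrm{rp}(\langle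 t^\zeta,f\rangle)$ exists, and $t^{\mathrm{MS}}$ is a distribution on $\mathbb R^n$ that extends $\tilde t$ and satisfies $\mathrm{sd}(t^{\mathrm{MS}})=\mathrm{sd}(\tilde t)$. 2. The principal part is a local distribution of order at most $\mathrm{sd}(\tilde t)-n$: there are finitely many multi-indices $\alpha$, all with $|\alpha|\le\mathrm{sd}(\tilde t)-n$, and polynomials $c_\alpha$ in $1/\zeta$ without constant term, independent of $f$, such that $\mathrm{pp}(\langle t^\zeta,f\rangle)=\sum_\alpha c_\alpha(1/\zeta)\,\langle\partial^\alpha\delta,f\rangle$ for all $\zeta\ne0$ and all $f\in\mathcal D(\mathbb R^n)$. -/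

import Mathlib

open Filter Topology TopologicalSpace
open scoped Distributions LineDeriv Polynomial

noncomputable section

namespace MinSub

/-- Euclidean space `ℝⁿ`. -/
abbrev Rn (n : ℕ) : Type := EuclideanSpace ℝ (Fin n)

/-- The open set `ℝⁿ ∖ {0}`. -/
def punctured (n : ℕ) : Opens (Rn n) := ⟨{0}ᶜ, isOpen_compl_singleton⟩

/-- `U` is scale invariant: it is mapped into itself (equivalently, onto itself) by every
dilation `x ↦ c x`, `c > 0`. -/
def IsScaleInvariant {n : ℕ} (U : Opens (Rn n)) : Prop :=
  ∀ c : ℝ, 0 < c → ∀ x ∈ U, c • x ∈ U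

theorem isScaleInvariant_top (n : ℕ) : IsScaleInvariant (⊤ : Opens (Rn n)) :=
  fun _ _ _ _ => trivial

theorem isScaleInvariant_punctured (n : ℕ) : IsScaleInvariant (punctured n) := by
  intro c hc x hx
  have hx' : x ≠ 0 := hx
  exact smul_ne_zero hc.ne' hx'

/-! ### Dilations and the scaling degree -/

theorem tsupport_comp_smul {n : ℕ} (f : Rn n → ℝ) {c : ℝ} (hc : c ≠ 0) :
    tsupport (fun x => f (c⁻¹ • x)) = (fun x => c⁻¹ • x) ⁻¹' tsupport f :=
  tsupport_comp_eq_preimage f (Homeomorph.smulOfNeZero c⁻¹ (inv_ne_zero hc))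

/-- The dilated test function `x ↦ f (x / c)` for `c > 0` (and `0` for the irrelevant values
`c ≤ 0`). -/
def dilate {n : ℕ} {U : Opens (Rn n)} (hU : IsScaleInvariant U) (c : ℝ) (f : 𝓓(U, ℝ)) :
    𝓓(U, ℝ) :=
  if hc : 0 < c then
    { toFun := fun x => f (c⁻¹ • x)
      contDiff' := f.contDiff.comp (contDiff_const_smul c⁻¹)
      hasCompactSupport' :=
        f.hasCompactSupport.comp_homeomorph (Homeomorph.smulOfNeZero c⁻¹ (inv_ne_zero hc.ne'))
      tsupport_subset' := by
        intro x hx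
        rw [tsupport_comp_smul _ hc.ne'] at hx
        have h := hU c hc _ (f.tsupport_subset hx)
        rwa [smul_inv_smul₀ hc.ne'] at h }
  else 0

theorem dilate_apply {n : ℕ} {U : Opens (Rn n)} (hU : IsScaleInvariant U) {c : ℝ} (hc : 0 < c)
    (f : 𝓓(U, ℝ)) (x : Rn n) : dilate hU c f x = f (c⁻¹ • x) := by
  simp only [dilate, hc, dif_pos]
  rfl

/-- The pairing `⟨t_c, f⟩ = c⁻ⁿ ⟨t, f (· / c)⟩` of the scaled distribution `t_c(x) = t(c x)`,
`c > 0`, with a test function. -/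
def scaledPairing {n : ℕ} {U : Opens (Rn n)} (hU : IsScaleInvariant U) (t : 𝓓'(U, ℂ)) (c : ℝ)
    (f : 𝓓(U, ℝ)) : ℂ :=
  (c ^ n)⁻¹ • t (dilate hU c f)

/-- The scaling degree `sd t = inf {δ ∈ ℝ | lim_{c → 0+} c ^ δ t_c = 0}` of a distribution on a
scale invariant open set, as an extended real number (`inf ∅ = +∞`). -/
def scalingDegree {n : ℕ} {U : Opens (Rn n)} (hU : IsScaleInvariant U) (t : 𝓓'(U, ℂ)) : EReal :=
  sInf ((fun δ : ℝ => (δ : EReal)) ''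
    {δ : ℝ | ∀ f : 𝓓(U, ℝ), Tendsto (fun c : ℝ => c ^ δ • scaledPairing hU t c f) (𝓝[>] 0) (𝓝 0)})

/-- Scaling degree of a distribution on `ℝⁿ ∖ {0}`. -/
abbrev sdPunctured {n : ℕ} (t : 𝓓'(punctured n, ℂ)) : EReal :=
  scalingDegree (isScaleInvariant_punctured n) t

/-- Scaling degree of a distribution on `ℝⁿ`. -/
abbrev sdWhole {n : ℕ} (t : 𝓓'((⊤ : Opens (Rn n)), ℂ)) : EReal :=
  scalingDegree (isScaleInvariant_top n) t

/-- The degree of divergence `div t = sd t - n` of a distribution on `ℝⁿ ∖ {0}`. -/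
def divDegree {n : ℕ} (t : 𝓓'(punctured n, ℂ)) : EReal := sdPunctured t - (n : ℝ)

/-! ### Extensions -/

/-- Extension by zero of test functions, `𝓓(ℝⁿ ∖ {0}) → 𝓓(ℝⁿ)`. -/
def incl {n : ℕ} (f : 𝓓(punctured n, ℝ)) : 𝓓((⊤ : Opens (Rn n)), ℝ) :=
  TestFunction.monoCLM ℝ f

theorem incl_apply {n : ℕ} (f : 𝓓(punctured n, ℝ)) (x : Rn n) : incl f x = f x := by
  simp [incl]

/-- The distribution `t` on `ℝⁿ` extends the distribution `t₀` on `ℝⁿ ∖ {0}`. -/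
def IsExtension {n : ℕ} (t : 𝓓'((⊤ : Opens (Rn n)), ℂ)) (t₀ : 𝓓'(punctured n, ℂ)) : Prop :=
  ∀ f : 𝓓(punctured n, ℝ), t (incl f) = t₀ f

/-! ### Multi-indices and the spaces `𝓓_l` -/

/-- The coordinate directions, listed with multiplicity, of the multi-index `α`: `α 0` times the
first basis vector, `α 1` times the second one, and so on. Hence `∂^{dirs α}` is the partial
derivative `∂^α`, and its order is `|α| = ∑ i, α i`. -/
def dirs {n : ℕ} (α : Fin n → ℕ) : Fin (∑ i, α i) → Rn n :=
  fun j => EuclideanSpace.single (finSigmaFinEquiv.symm j).1 (1 : ℝ)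

/-- The order `|α|` of a multi-index is at most the extended real number `l`. -/
def OrderLE {n : ℕ} (α : Fin n → ℕ) (l : EReal) : Prop :=
  (((∑ i, α i : ℕ) : ℝ) : EReal) ≤ l

/-- The space `𝓓_l(ℝⁿ)` of the test functions `g` with `(∂^α g)(0) = 0` for all `|α| ≤ l`. -/
def flatSubmodule (n : ℕ) (l : EReal) : Submodule ℝ 𝓓((⊤ : Opens (Rn n)), ℝ) where
  carrier := {g | ∀ α : Fin n → ℕ, OrderLE α l → (∂^{dirs α} g) 0 = 0}
  zero_mem' := by
    intro α _
    rw [LineDeriv.iteratedLineDerivOp_zero]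
    rfl
  add_mem' := by
    intro a b ha hb α hα
    rw [LineDeriv.iteratedLineDerivOp_add]
    change (∂^{dirs α} a) 0 + (∂^{dirs α} b) 0 = 0
    rw [ha α hα, hb α hα, add_zero]
  smul_mem' := by
    intro r a ha α hα
    rw [LineDeriv.iteratedLineDerivOp_smul]
    change r • (∂^{dirs α} a) 0 = 0
    rw [ha α hα, smul_zero]

theorem lineDeriv_apply {n : ℕ} {U : Opens (Rn n)} (v : Rn n) (f : 𝓓(U, ℝ)) (x : Rn n) :
    (∂_{v} f) x = lineDeriv ℝ f x v := by
  rw [TestFunction.lineDerivOp_eq_lineDerivCLM ℝ]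
  simp

theorem lineDeriv_dilate {n : ℕ} {U : Opens (Rn n)} (hU : IsScaleInvariant U) {c : ℝ}
    (hc : 0 < c) (v : Rn n) (f : 𝓓(U, ℝ)) :
    ∂_{v} (dilate hU c f) = c⁻¹ • dilate hU c (∂_{v} f) := by
  ext x
  change (∂_{v} (dilate hU c f)) x = c⁻¹ • (dilate hU c (∂_{v} f)) x
  rw [dilate_apply hU hc, lineDeriv_apply, lineDeriv_apply]
  have h1 : (dilate hU c f : Rn n → ℝ) = fun y => f (c⁻¹ • y) :=
    funext fun y => dilate_apply hU hc f y
  have hd : Differentiable ℝ f := f.contDiff.differentiable (by simp)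
  rw [h1, (hd _).lineDeriv_eq_fderiv]
  have h2 : DifferentiableAt ℝ (fun y => f (c⁻¹ • y)) x :=
    (hd _).comp x (differentiableAt_id.const_smul c⁻¹)
  rw [h2.lineDeriv_eq_fderiv]
  have h3 : HasFDerivAt (fun y : Rn n => f (c⁻¹ • y))
      ((fderiv ℝ f (c⁻¹ • x)).comp (c⁻¹ • ContinuousLinearMap.id ℝ (Rn n))) x :=
    HasFDerivAt.comp x (hd _).hasFDerivAt ((hasFDerivAt_id x).const_smul c⁻¹)
  rw [h3.fderiv]
  simp

theorem iteratedLineDeriv_dilate {n : ℕ} {U : Opens (Rn n)} (hU : IsScaleInvariant U) {c : ℝ}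
    (hc : 0 < c) {k : ℕ} (m : Fin k → Rn n) (f : 𝓓(U, ℝ)) :
    ∂^{m} (dilate hU c f) = (c⁻¹) ^ k • dilate hU c (∂^{m} f) := by
  induction k with
  | zero => simp [LineDeriv.iteratedLineDerivOp_fin_zero]
  | succ k ih =>
    rw [LineDeriv.iteratedLineDerivOp_succ_left, ih, LineDeriv.lineDerivOp_smul,
      lineDeriv_dilate hU hc, LineDeriv.iteratedLineDerivOp_succ_left, smul_smul, pow_succ]

/-- `𝓓_l(ℝⁿ)` is invariant under dilations. -/
theorem dilate_mem_flat {n : ℕ} {l : EReal} (c : ℝ) {g : 𝓓((⊤ : Opens (Rn n)), ℝ)}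
    (hg : g ∈ flatSubmodule n l) : dilate (isScaleInvariant_top n) c g ∈ flatSubmodule n l := by
  by_cases hc : 0 < c
  · intro α hα
    rw [iteratedLineDeriv_dilate _ hc]
    change c⁻¹ ^ _ • (dilate (isScaleInvariant_top n) c (∂^{dirs α} g)) 0 = 0
    rw [dilate_apply _ hc, smul_zero, hg α hα, smul_zero]
  · have : dilate (isScaleInvariant_top n) c g = 0 := by simp [dilate, hc]
    rw [this]
    exact Submodule.zero_mem _

theorem lineDeriv_incl {n : ℕ} (v : Rn n) (f : 𝓓(punctured n, ℝ)) :
    ∂_{v} (incl f) = incl (∂_{v} f) := by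
  ext x
  rw [incl_apply, lineDeriv_apply, lineDeriv_apply]
  congr 1
  exact funext fun y => incl_apply f y

theorem iteratedLineDeriv_incl {n : ℕ} {k : ℕ} (m : Fin k → Rn n) (f : 𝓓(punctured n, ℝ)) :
    ∂^{m} (incl f) = incl (∂^{m} f) := by
  induction k with
  | zero => simp [LineDeriv.iteratedLineDerivOp_fin_zero]
  | succ k ih =>
    rw [LineDeriv.iteratedLineDerivOp_succ_left, ih, lineDeriv_incl,
      LineDeriv.iteratedLineDerivOp_succ_left]

/-- Test functions on `ℝⁿ ∖ {0}` belong to every `𝓓_l(ℝⁿ)`. -/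
theorem incl_mem_flat {n : ℕ} (l : EReal) (f : 𝓓(punctured n, ℝ)) :
    incl f ∈ flatSubmodule n l := by
  intro α _
  rw [iteratedLineDeriv_incl, incl_apply]
  exact image_eq_zero_of_notMem_tsupport
    fun h => (TestFunction.tsupport_subset (∂^{dirs α} f) h) rfl

/-- The distributions `𝓓'_l(ℝⁿ)` on the space `𝓓_l(ℝⁿ)`, which carries the topology induced
by `𝓓(ℝⁿ)`. -/
abbrev FlatDistribution (n : ℕ) (l : EReal) : Type := flatSubmodule n l →L[ℝ] ℂ

/-- The scaling degree of an element of `𝓓'_l(ℝⁿ)`, defined by the same formula as for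
distributions. -/
def sdFlat {n : ℕ} {l : EReal} (t : FlatDistribution n l) : EReal :=
  sInf ((fun δ : ℝ => (δ : EReal)) ''
    {δ : ℝ | ∀ g : flatSubmodule n l,
      Tendsto (fun c : ℝ => c ^ δ • ((c ^ n)⁻¹ •
        t ⟨dilate (isScaleInvariant_top n) c g, dilate_mem_flat c g.2⟩)) (𝓝[>] 0) (𝓝 0)})

/-- `tbar` is the extension of `t₀` to `𝓓_l(ℝⁿ)`, `l = div t₀`, with the same scaling degree
(equivalently, the same degree of divergence) as `t₀`. For `sd t₀ < ∞` there is exactly one such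
extension. -/
def IsFlatExtension {n : ℕ} (t₀ : 𝓓'(punctured n, ℂ))
    (tbar : FlatDistribution n (divDegree t₀)) : Prop :=
  (∀ f : 𝓓(punctured n, ℝ), tbar ⟨incl f, incl_mem_flat _ f⟩ = t₀ f) ∧
    sdFlat tbar = sdPunctured t₀

/-! ### Regularizations -/

/-- The family `t ζ`, `ζ ∈ Ω ∖ {0}`, with `Ω` a neighbourhood of `0`, is a regularization of `t₀`:
on `𝓓_l(ℝⁿ)`, `l = div t₀`, it converges pointwise as `ζ → 0` to the extension `tbar` of `t₀` with
the same degree of divergence. The values of `t` outside `Ω ∖ {0}` play no role. -/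
structure IsRegularization {n : ℕ} (t₀ : 𝓓'(punctured n, ℂ)) (Ω : Set ℂ)
    (t : ℂ → 𝓓'((⊤ : Opens (Rn n)), ℂ)) : Prop where
  nhds_zero : Ω ∈ 𝓝 (0 : ℂ)
  tendsto : ∀ tbar : FlatDistribution n (divDegree t₀), IsFlatExtension t₀ tbar →
    ∀ g : flatSubmodule n (divDegree t₀),
      Tendsto (fun ζ : ℂ => t ζ (g : 𝓓((⊤ : Opens (Rn n)), ℝ))) (𝓝[≠] 0) (𝓝 (tbar g))

/-- The regularization is analytic: for every test function `f` the map `ζ ↦ ⟨t ζ, f⟩` is analytic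
on `Ω ∖ {0}` with at most a pole of finite order at `0`. -/
structure IsAnalyticRegularization {n : ℕ} (t₀ : 𝓓'(punctured n, ℂ)) (Ω : Set ℂ)
    (t : ℂ → 𝓓'((⊤ : Opens (Rn n)), ℂ)) : Prop extends IsRegularization t₀ Ω t where
  analyticOn : ∀ f : 𝓓((⊤ : Opens (Rn n)), ℝ), AnalyticOn ℂ (fun ζ => t ζ f) (Ω \ {0})
  meromorphicAt : ∀ f : 𝓓((⊤ : Opens (Rn n)), ℝ), MeromorphicAt (fun ζ => t ζ f) 0

/-! ### Principal and regular part of a Laurent series at `0` -/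

/-- The polynomial `p` without constant term gives the principal part of `F` at `0`: near `0`,
`F ζ = p (1 / ζ) + g ζ` with `g` analytic at `0`. -/
def IsPrincipalPoly (F : ℂ → ℂ) (p : ℂ[X]) : Prop :=
  p.coeff 0 = 0 ∧
    ∃ g : ℂ → ℂ, AnalyticAt ℂ g 0 ∧ ∀ᶠ ζ in 𝓝[≠] (0 : ℂ), F ζ = p.eval ζ⁻¹ + g ζ

open scoped Classical in
/-- The polynomial in `1 / ζ` that is the principal part of `F` at `0` (`0` if `F` is not
meromorphic at `0`). -/
def principalPoly (F : ℂ → ℂ) : ℂ[X] :=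
  if h : ∃ p, IsPrincipalPoly F p then h.choose else 0

/-- The principal part `pp(F)` of the Laurent series of `F` at `0`. -/
def principalPart (F : ℂ → ℂ) (ζ : ℂ) : ℂ := (principalPoly F).eval ζ⁻¹

/-- The regular part `rp(F) = F - pp(F)`. -/
def regularPart (F : ℂ → ℂ) (ζ : ℂ) : ℂ := F ζ - principalPart F ζ

theorem exists_isPrincipalPoly_aux (N : ℕ) : ∀ h : ℂ → ℂ, AnalyticAt ℂ h 0 →
    ∃ p : ℂ[X], p.coeff 0 = 0 ∧ ∃ g : ℂ → ℂ, AnalyticAt ℂ g 0 ∧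
      ∀ᶠ ζ in 𝓝[≠] (0 : ℂ), (ζ⁻¹) ^ N * h ζ = p.eval ζ⁻¹ + g ζ := by
  induction N with
  | zero => intro h hh; exact ⟨0, by simp, h, hh, by simp⟩
  | succ N ih =>
    intro h hh
    have hk : AnalyticAt ℂ (dslope h 0) 0 := by
      obtain ⟨q, hq⟩ := hh
      exact ⟨_, hq.has_fpower_series_dslope_fslope⟩
    obtain ⟨p, hp, g, hg, hpg⟩ := ih _ hk
    refine ⟨p + Polynomial.C (h 0) * Polynomial.X ^ (N + 1), by simp [hp], g, hg, ?_⟩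
    filter_upwards [hpg, self_mem_nhdsWithin] with ζ h1 h2
    have h2' : ζ ≠ 0 := h2
    have h3 : h ζ = h 0 + ζ * dslope h 0 ζ := by
      rw [dslope_of_ne _ h2', slope_def_field]
      field_simp
      ring
    rw [h3, Polynomial.eval_add, add_right_comm, ← h1]
    simp only [Polynomial.eval_mul, Polynomial.eval_C, Polynomial.eval_pow, Polynomial.eval_X]
    linear_combination (ζ⁻¹ ^ N * dslope h 0 ζ) * mul_inv_cancel₀ h2'

/-- Every function meromorphic at `0` has a principal part. -/
theorem exists_isPrincipalPoly {F : ℂ → ℂ} (hF : MeromorphicAt F 0) :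
    ∃ p, IsPrincipalPoly F p := by
  obtain ⟨N, hN⟩ := hF
  obtain ⟨p, hp, g, hg, h⟩ := exists_isPrincipalPoly_aux N _ hN
  refine ⟨p, hp, g, hg, ?_⟩
  filter_upwards [h, self_mem_nhdsWithin] with ζ h1 h2
  have h2' : ζ ≠ 0 := h2
  rw [← h1]
  rw [sub_zero, smul_eq_mul, inv_pow, inv_mul_cancel_left₀ (pow_ne_zero N h2')]

/-- The principal part is unique. -/
theorem IsPrincipalPoly.unique {F : ℂ → ℂ} {p q : ℂ[X]} (hp : IsPrincipalPoly F p)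
    (hq : IsPrincipalPoly F q) : p = q := by
  obtain ⟨hp0, g, hg, hpg⟩ := hp
  obtain ⟨hq0, k, hk, hqk⟩ := hq
  have hlim : Tendsto (fun ζ : ℂ => (p - q).eval ζ⁻¹) (𝓝[≠] 0) (𝓝 (k 0 - g 0)) := by
    have h := (hk.continuousAt.tendsto.sub hg.continuousAt.tendsto).mono_left
      (nhdsWithin_le_nhds (s := {(0 : ℂ)}ᶜ))
    refine h.congr' ?_
    filter_upwards [hpg, hqk] with ζ h1 h2
    rw [Polynomial.eval_sub]
    linear_combination h1 - h2
  by_contra hne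
  have hdeg : 0 < (p - q).degree := by
    by_contra hd
    have h1 := Polynomial.eq_C_of_degree_le_zero (not_lt.mp hd)
    rw [Polynomial.coeff_sub, hp0, hq0, sub_zero, Polynomial.C_0] at h1
    exact hne (sub_eq_zero.mp h1)
  have hinf := Polynomial.tendsto_norm_atTop (p - q) hdeg
    (tendsto_norm_inv_nhdsNE_zero_atTop (α := ℂ))
  exact not_tendsto_nhds_of_tendsto_atTop hinf _ hlim.norm

theorem isPrincipalPoly_principalPoly {F : ℂ → ℂ} (hF : MeromorphicAt F 0) :
    IsPrincipalPoly F (principalPoly F) := by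
  have h := exists_isPrincipalPoly hF
  rw [principalPoly, dif_pos h]
  exact h.choose_spec

/-! ### Local distributions -/

/-- The derivative `∂^α δ` of the Dirac distribution at `0`, as a complex distribution on `ℝⁿ`. -/
def deltaDeriv {n : ℕ} (α : Fin n → ℕ) : 𝓓'((⊤ : Opens (Rn n)), ℂ) :=
  ∂^{dirs α} (Distribution.mapCLM Complex.ofRealCLM
    (Distribution.delta (0 : Rn n) : 𝓓'((⊤ : Opens (Rn n)), ℝ)))

end MinSub

end

/-!
Write `l = sd t₀ - n`, and let `m` be the least natural number exceeding `l`, so that `𝓓_l` consists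
of the test functions all of whose derivatives of order less than `m` vanish at the origin.

The hypothesis on a regularization only speaks about extensions of `t₀` to `𝓓_l` with the same
scaling degree, so such an extension has to be constructed first. For `δ > sd t₀` the linear forms
`f ↦ c ^ (δ - n) ⟨t₀, f (· / c)⟩`, `0 < c ≤ 1`, are pointwise bounded. The spaces `𝓓_K` of smooth
functions supported in a compact set are complete and metrizable, hence barrelled, and so these
forms are equicontinuous on each `𝓓_K`. By Taylor's formula the functions `ε ^ (-m) φ g (ε ·)`,
with `g ∈ 𝓓_l` and `φ` supported in an annulus, form a bounded set. Together this gives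
`⟨t₀, φ (· / ε) g⟩ = O(ε ^ (n - δ + m))`, uniformly under dilations
(`exists_bound_dilate_cutoff_dilate`). For `δ < n + m` the truncations of `t₀` away from the balls
of radius `2⁻ᵏ` therefore converge on `𝓓_l` like a geometric series, to an extension that scales
like `t₀` (`exists_flat_extension`). Its continuity is again uniform boundedness, applied after
composition with the continuous projection
`W f = f - ∑_{|α| < m} (∂^α f)(0) w_α` onto `𝓓_l`, where `w_α` equals `x ^ α / α!` near `0`.

Now let `t ζ` be an analytic regularization. Since `⟨t ζ, W f⟩` has a limit, it has no principal
part, and `pp ⟨t ζ, f⟩ = ∑_{|α| < m} (∂^α f)(0) pp ⟨t ζ, w_α⟩`. This is the local distribution of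
the second assertion, and it shows that the regular part of `⟨t ζ, f⟩` converges to the sum of the
extension of `t₀` constructed above, applied to `W f`, and a combination of the `(∂^α f)(0)`.
The scaling degree of the limit is controlled on `𝓓_l` by construction; on `w_α` it is controlled
by `isPowerBounded_dualJet`, because `w_α (2 ·) - 2 ^ |α| w_α` lies in `𝓓_l` and
`|α| + n ≤ sd t₀`.
-/

/-! ### The Fréchet space of smooth functions supported in a compact set -/

namespace ContDiffMapSupportedIn

variable {E F : Type*} [NormedAddCommGroup E] [NormedSpace ℝ E] [NormedAddCommGroup F]
  [NormedSpace ℝ F] {K : Compacts E}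

/-- A sequence of smooth functions all of whose derivatives converge uniformly has a smooth
limit, the derivatives of which are the limits of the derivatives. -/
theorem isClosed_range_structureMap :
    IsClosed (Set.range (ContinuousLinearMap.pi (structureMapCLM ℝ ⊤) :
      𝓓_{K}(E, F) →L[ℝ] Π i, BoundedContinuousFunction E (E [×i]→L[ℝ] F))) := by
  refine IsSeqClosed.isClosed fun g a hg ha => ?_
  choose f hf using hg
  have hgf : ∀ k i x, g k i x = iteratedFDeriv ℝ i (f k) x := by
    intro k i x
    rw [← hf k]
    exact congrFun (structureMapCLM_top_apply ℝ (f k)) x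
  have hunif : ∀ i, TendstoUniformly (fun k => (g k i : E → E [×i]→L[ℝ] F)) (a i) atTop :=
    fun i => BoundedContinuousFunction.tendsto_iff_tendstoUniformly.1 ((tendsto_pi_nhds.1 ha) i)
  have hptw : ∀ i x, Tendsto (fun k => g k i x) atTop (𝓝 (a i x)) :=
    fun i x => (hunif i).tendsto_at x
  have hT : HasFTaylorSeriesUpTo ((⊤ : ℕ∞) : WithTop ℕ∞) (fun x => (a 0 x).curry0)
      (fun x i => a i x) := by
    refine ⟨fun x => rfl, fun i _ x => ?_, fun i _ => (a i).continuous⟩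
    refine hasFDerivAt_of_tendstoUniformly (f := fun k => (g k i : E → E [×i]→L[ℝ] F))
      (f' := fun k x => (g k (i + 1) x).curryLeft) (g' := fun x => (a (i + 1) x).curryLeft)
      (l := atTop) ?_ ?_ (hptw i) x
    · exact (continuousMultilinearCurryLeftEquiv ℝ (fun _ : Fin (i + 1) => E) F)
        |>.isometry.uniformContinuous.comp_tendstoUniformly (hunif (i + 1))
    · intro k x
      have h := ((f k).contDiff.ftaylorSeries).fderiv i (by exact_mod_cast WithTop.coe_lt_top i) x
      have h1 : (g k i : E → E [×i]→L[ℝ] F) = fun y => ftaylorSeries ℝ (f k) y i :=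
        funext fun y => hgf k i y
      rw [h1, hgf k (i + 1) x]
      exact h
  refine ⟨⟨fun x => (a 0 x).curry0, hT.contDiff, fun x hx => ?_⟩, ?_⟩
  · have h0 : ∀ k, g k 0 x = 0 := fun k => by
      rw [hgf]
      exact (f k).iteratedFDeriv_zero_on_compl hx
    have h1 := hptw 0 x
    simp only [h0] at h1
    have h2 : a 0 x = 0 := (tendsto_nhds_unique h1 tendsto_const_nhds)
    simp [h2]
  · ext i x : 2
    have h := hT.eq_iteratedFDeriv (m := i) (by exact_mod_cast le_top) x
    rw [h]
    exact congrFun (structureMapCLM_top_apply ℝ (⟨fun x => (a 0 x).curry0, _, _⟩ :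
      𝓓_{K}(E, F))) x

instance completeSpace [CompleteSpace F] : CompleteSpace 𝓓_{K}(E, F) :=
  (completeSpace_iff_isComplete_range
    (isUniformEmbedding_pi_structureMapCLM ℝ).isUniformInducing).2
      isClosed_range_structureMap.isComplete

instance baireSpace [CompleteSpace F] : BaireSpace 𝓓_{K}(E, F) := by
  have : (uniformity 𝓓_{K}(E, F)).IsCountablyGenerated := by
    rw [← (isUniformEmbedding_pi_structureMapCLM (E := E) (F := F) (n := ⊤) (K := K)
      ℝ).isUniformInducing.comap_uniformity]
    infer_instance
  let := UniformSpace.pseudoMetricSpace 𝓓_{K}(E, F)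
  infer_instance

/-- Uniform boundedness: a pointwise bounded family of continuous linear forms is bounded on
every set of functions whose derivatives of each order are uniformly bounded. -/
theorem exists_bound_of_pointwise_bound {ι κ : Type*} {G : Type*} [NormedAddCommGroup G]
    [NormedSpace ℝ G] [CompleteSpace F] (T : ι → 𝓓_{K}(E, F) →L[ℝ] G)
    (hT : ∀ f, ∃ C, ∀ i, ‖T i f‖ ≤ C) (f : κ → 𝓓_{K}(E, F))
    (hf : ∀ j : ℕ, ∃ M, ∀ k, ∀ x ∈ K, ‖iteratedFDeriv ℝ j (f k) x‖ ≤ M) :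
    ∃ C, ∀ i k, ‖T i (f k)‖ ≤ C := by
  let p : ι → Seminorm ℝ 𝓓_{K}(E, F) := fun i => (normSeminorm ℝ G).comp (T i).toLinearMap
  have hp : BddAbove (Set.range p) := by
    rw [Seminorm.bddAbove_range_iff]
    intro x
    obtain ⟨C, hC⟩ := hT x
    exact ⟨C, by rintro _ ⟨i, rfl⟩; exact hC i⟩
  have hcont : Continuous (⨆ i, p i : Seminorm ℝ 𝓓_{K}(E, F)) := by
    rw [Seminorm.coe_iSup_eq hp]
    exact Seminorm.continuous_iSup p (fun i => (T i).continuous.norm) hp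
  obtain ⟨s, C, -, hle⟩ := Seminorm.bound_of_continuous
    (ContDiffMapSupportedIn.withSeminorms ℝ E F ⊤ K) _ hcont
  choose M hM using hf
  refine ⟨C * ∑ j ∈ s, max (M j) 0, fun i k => ?_⟩
  have h1 : p i (f k) ≤ (⨆ i, p i : Seminorm ℝ 𝓓_{K}(E, F)) (f k) := by
    rw [Seminorm.coe_iSup_eq hp, iSup_apply]
    obtain ⟨B, hB⟩ := hT (f k)
    exact le_ciSup (f := fun i => p i (f k)) ⟨B, by rintro _ ⟨i, rfl⟩; exact hB i⟩ i
  have h2 : (s.sup (ContDiffMapSupportedIn.seminorm ℝ E F ⊤ K)) (f k) ≤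
      ∑ j ∈ s, max (M j) 0 := by
    refine Seminorm.finset_sup_apply_le (Finset.sum_nonneg fun _ _ => le_max_right _ _)
      fun j hj => ?_
    refine le_trans ?_ (Finset.single_le_sum (f := fun j => max (M j) 0)
      (fun _ _ => le_max_right _ _) hj)
    rw [ContDiffMapSupportedIn.seminorm_top_le_iff ℝ (le_max_right _ _)]
    exact fun x hx => (hM j k x hx).trans (le_max_left _ _)
  exact h1.trans ((hle (f k)).trans (mul_le_mul_of_nonneg_left h2 C.2))

/-- A map into a space of functions with smaller support is continuous if it is so as a map into
a space of functions with larger support. -/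
theorem continuous_of_coe_eq {X : Type*} [TopologicalSpace X] {K₁ K₂ : Compacts E}
    {φ : X → 𝓓_{K₁}(E, F)} {ψ : X → 𝓓_{K₂}(E, F)} (hψ : Continuous ψ)
    (h : ∀ x, (φ x : E → F) = ψ x) : Continuous φ := by
  rw [continuous_iff_comp] at hψ ⊢
  intro i
  convert! hψ i using 1
  ext x y : 2
  simp [h]

end ContDiffMapSupportedIn

namespace TestFunction

variable {E F G : Type*} [NormedAddCommGroup E] [NormedSpace ℝ E] [NormedAddCommGroup F]
  [NormedSpace ℝ F] [CompleteSpace F] [NormedAddCommGroup G] [NormedSpace ℝ G] {Ω : Opens E}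

/-- Uniform boundedness for test functions: a pointwise bounded family of continuous linear forms
is bounded on every set of test functions with support in a common compact set whose derivatives
of each order are uniformly bounded. -/
theorem exists_bound_of_pointwise_bound {ι κ : Type*} (T : ι → 𝓓(Ω, F) →L[ℝ] G)
    (hT : ∀ f, ∃ C, ∀ i, ‖T i f‖ ≤ C) (K : Compacts E) (hK : (K : Set E) ⊆ Ω) (f : κ → 𝓓(Ω, F))
    (hfK : ∀ k, ∀ x ∉ K, f k x = 0)
    (hf : ∀ j : ℕ, ∃ M, ∀ k, ∀ x ∈ K, ‖iteratedFDeriv ℝ j (f k) x‖ ≤ M) :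
    ∃ C, ∀ i k, ‖T i (f k)‖ ≤ C :=
  ContDiffMapSupportedIn.exists_bound_of_pointwise_bound (K := K)
    (fun i => (T i).comp (ofSupportedInCLM ℝ hK)) (fun g => hT (ofSupportedIn hK g))
    (fun k => ⟨f k, (f k).contDiff, fun x hx => hfK k x hx⟩) hf

/-- The pointwise limit of a sequence of continuous linear forms on the space of test functions
is continuous. -/
theorem exists_clm_of_tendsto (u : ℕ → 𝓓(Ω, F) →L[ℝ] G)
    (hu : ∀ f, ∃ z, Tendsto (fun k => u k f) atTop (𝓝 z)) :
    ∃ T : 𝓓(Ω, F) →L[ℝ] G, ∀ f, Tendsto (fun k => u k f) atTop (𝓝 (T f)) := by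
  choose T hT using hu
  refine ⟨TestFunction.mkCLM ℝ T (fun f g => ?_) (fun c f => ?_) (fun K hK => ?_), hT⟩
  · refine tendsto_nhds_unique (hT (f + g)) ?_
    simpa using (hT f).add (hT g)
  · refine tendsto_nhds_unique (hT (c • f)) ?_
    simpa using (hT f).const_smul c
  · exact (continuousLinearMapOfTendsto (l := atTop)
      (fun k => (u k).comp (ofSupportedInCLM ℝ hK)) (f := T ∘ ofSupportedIn hK)
      (tendsto_pi_nhds.2 fun f => hT (ofSupportedIn hK f))).continuous

end TestFunction

noncomputable section
namespace MinSub

/-! ### Dilations and cutoffs of test functions -/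

variable {n : ℕ}

theorem iteratedFDeriv_dilate {U : Opens (Rn n)} (hU : IsScaleInvariant U) {c : ℝ} (hc : 0 < c)
    (f : 𝓓(U, ℝ)) (j : ℕ) (x : Rn n) :
    iteratedFDeriv ℝ j (dilate hU c f) x = c⁻¹ ^ j • iteratedFDeriv ℝ j f (c⁻¹ • x) := by
  have h1 : (dilate hU c f : Rn n → ℝ) = fun y => f (c⁻¹ • y) :=
    funext fun y => dilate_apply hU hc f y
  rw [h1, iteratedFDeriv_comp_const_smul c⁻¹ (f.contDiff.of_le (by exact_mod_cast le_top))]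

/-- The image of a compact set under a dilation. -/
def smulCompacts (c : ℝ) (K : Compacts (Rn n)) : Compacts (Rn n) :=
  K.map (fun x => c • x) (continuous_const_smul c)

/-- The dilation `f ↦ f (· / c)` on the functions supported in `K`, for `c > 0`. -/
def dilateSupportedIn {c : ℝ} (hc : 0 < c) (K : Compacts (Rn n)) :
    𝓓_{K}(Rn n, ℝ) →L[ℝ] 𝓓_{smulCompacts c K}(Rn n, ℝ) :=
  ContDiffMapSupportedIn.mkCLM ℝ (fun f x => f (c⁻¹ • x)) (fun _ _ _ => rfl) (fun _ _ _ => rfl)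
    (fun f => f.contDiff.comp (contDiff_const_smul c⁻¹))
    (fun f x hx => f.zero_on_compl fun h =>
      hx ⟨c⁻¹ • x, h, smul_inv_smul₀ hc.ne' x⟩)
    (fun i _ => ⟨{i}, c⁻¹ ^ i, by positivity, fun f x _ => by
      rw [iteratedFDeriv_comp_const_smul c⁻¹ (f.contDiff.of_le (by exact_mod_cast le_top)),
        norm_smul, norm_pow, Real.norm_of_nonneg (inv_nonneg.2 hc.le), Finset.sup_singleton]
      exact mul_le_mul_of_nonneg_left
        (ContDiffMapSupportedIn.norm_iteratedFDeriv_apply_le_seminorm_top ℝ) (by positivity)⟩)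

theorem exists_dilateCLM {U : Opens (Rn n)} (hU : IsScaleInvariant U) (c : ℝ) :
    ∃ D : 𝓓(U, ℝ) →L[ℝ] 𝓓(U, ℝ), ∀ f, D f = dilate hU c f := by
  by_cases hc : 0 < c
  · have hK : ∀ K : Compacts (Rn n), (K : Set (Rn n)) ⊆ U →
        (smulCompacts c K : Set (Rn n)) ⊆ U := by
      rintro K hKU _ ⟨x, hx, rfl⟩
      exact hU c hc x (hKU hx)
    refine ⟨TestFunction.limitCLM ℝ (dilate hU c) (fun K hKU =>
      (TestFunction.ofSupportedInCLM ℝ (hK K hKU)).comp (dilateSupportedIn hc K)) ?_, fun f => rfl⟩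
    intro K hKU f
    ext x
    rw [dilate_apply hU hc]
    rfl
  · exact ⟨0, fun f => by simp [dilate, hc]⟩

/-- The dilation `f ↦ f (· / c)` of test functions as a continuous linear map. -/
def dilateCLM {U : Opens (Rn n)} (hU : IsScaleInvariant U) (c : ℝ) : 𝓓(U, ℝ) →L[ℝ] 𝓓(U, ℝ) :=
  (exists_dilateCLM hU c).choose

@[simp]
theorem dilateCLM_apply {U : Opens (Rn n)} (hU : IsScaleInvariant U) (c : ℝ) (f : 𝓓(U, ℝ)) :
    dilateCLM hU c f = dilate hU c f :=
  (exists_dilateCLM hU c).choose_spec f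

theorem dilate_dilate {U : Opens (Rn n)} (hU : IsScaleInvariant U) {b c : ℝ} (hb : 0 < b)
    (hc : 0 < c) (f : 𝓓(U, ℝ)) : dilate hU b (dilate hU c f) = dilate hU (b * c) f := by
  ext x
  rw [dilate_apply hU hb, dilate_apply hU hc, dilate_apply hU (mul_pos hb hc), smul_smul,
    mul_inv, mul_comm]

theorem dilate_one {U : Opens (Rn n)} (hU : IsScaleInvariant U) (f : 𝓓(U, ℝ)) :
    dilate hU 1 f = f := by
  ext x
  rw [dilate_apply hU one_pos, inv_one, one_smul]

theorem dilate_incl (c : ℝ) (f : 𝓓(punctured n, ℝ)) :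
    dilate (isScaleInvariant_top n) c (incl f) =
      incl (dilate (isScaleInvariant_punctured n) c f) := by
  by_cases hc : 0 < c
  · ext x
    rw [dilate_apply _ hc, incl_apply, incl_apply, dilate_apply _ hc]
  · simp [dilate, hc, incl]

/-- A smooth function that vanishes near the origin. -/
structure IsCutoff (a : Rn n → ℝ) : Prop where
  contDiff : ContDiff ℝ ((⊤ : ℕ∞) : WithTop ℕ∞) a
  zero_notMem : (0 : Rn n) ∉ tsupport a

theorem IsCutoff.comp_smul {a : Rn n → ℝ} (ha : IsCutoff a) {c : ℝ} (hc : c ≠ 0) :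
    IsCutoff (fun x => a (c⁻¹ • x)) := by
  refine ⟨ha.contDiff.comp (contDiff_const_smul c⁻¹), ?_⟩
  rw [tsupport_comp_smul a hc]
  simpa using ha.zero_notMem

theorem IsCutoff.sub {a b : Rn n → ℝ} (ha : IsCutoff a) (hb : IsCutoff b) :
    IsCutoff (fun x => a x - b x) :=
  ⟨ha.contDiff.sub hb.contDiff, fun h => by
    rcases tsupport_sub a b h with h | h
    exacts [ha.zero_notMem h, hb.zero_notMem h]⟩

theorem exists_cutoffCLM {a : Rn n → ℝ} (ha : IsCutoff a) :
    ∃ D : 𝓓((⊤ : Opens (Rn n)), ℝ) →L[ℝ] 𝓓(punctured n, ℝ), ∀ f x, D f x = a x * f x := by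
  have hsupp : ∀ f : Rn n → ℝ, tsupport (fun x => a x * f x) ⊆ (punctured n : Set (Rn n)) := by
    intro f x hx h0
    exact ha.zero_notMem ((h0 : x = 0) ▸ (tsupport_mul_subset_left hx))
  let Φ : 𝓓((⊤ : Opens (Rn n)), ℝ) → 𝓓(punctured n, ℝ) := fun f =>
    ⟨fun x => a x * f x, ha.contDiff.mul f.contDiff, f.hasCompactSupport.mul_left, hsupp f⟩
  have hcont : ∀ (K : Compacts (Rn n)), Continuous
      (Φ ∘ TestFunction.ofSupportedIn (Set.subset_univ (K : Set (Rn n)))) := by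
    intro K
    let K' : Compacts (Rn n) := ⟨(K : Set (Rn n)) ∩ tsupport a,
      K.isCompact.inter_right (isClosed_tsupport a)⟩
    have hK' : (K' : Set (Rn n)) ⊆ punctured n := fun x hx h0 =>
      ha.zero_notMem ((h0 : x = 0) ▸ hx.2)
    let φ : 𝓓_{K}(Rn n, ℝ) → 𝓓_{K'}(Rn n, ℝ) := fun f =>
      ⟨fun x => a x * f x, ha.contDiff.mul f.contDiff, fun x hx => by
        by_cases hxK : x ∈ K
        · have : a x = 0 := image_eq_zero_of_notMem_tsupport fun h => hx ⟨hxK, h⟩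
          simp [this]
        · have : f x = 0 := f.zero_on_compl hxK
          simp [this]⟩
    have hφ : Continuous φ := by
      refine ContDiffMapSupportedIn.continuous_of_coe_eq
        (ContDiffMapSupportedIn.bilinLeftCLM (ContinuousLinearMap.mul ℝ ℝ) ha.contDiff).continuous
        fun f => ?_
      ext x
      exact mul_comm _ _
    exact (TestFunction.continuous_ofSupportedIn hK').comp hφ
  refine ⟨TestFunction.mkCLM ℝ Φ (fun f g => ?_) (fun c f => ?_) (fun K _ => hcont K),
    fun f x => rfl⟩
  · ext x
    exact mul_add _ _ _
  · ext x
    exact mul_left_comm _ _ _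

/-- Multiplication by a smooth function `a` that vanishes near the origin, as a continuous linear
map `𝓓(ℝⁿ) → 𝓓(ℝⁿ ∖ {0})`. -/
def cutoffCLM {a : Rn n → ℝ} (ha : IsCutoff a) :
    𝓓((⊤ : Opens (Rn n)), ℝ) →L[ℝ] 𝓓(punctured n, ℝ) :=
  (exists_cutoffCLM ha).choose

theorem cutoffCLM_apply {a : Rn n → ℝ} (ha : IsCutoff a) (f : 𝓓((⊤ : Opens (Rn n)), ℝ))
    (x : Rn n) : cutoffCLM ha f x = a x * f x :=
  (exists_cutoffCLM ha).choose_spec f x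

/-! ### Growth under dilations -/

/-- The function `F` is `O(c ^ κ)` for `c ∈ (0, 1]`. -/
def IsPowerBounded (F : ℝ → ℂ) (κ : ℝ) : Prop :=
  ∃ C, ∀ c : ℝ, 0 < c → c ≤ 1 → ‖F c‖ ≤ C * c ^ κ

theorem IsPowerBounded.add {F G : ℝ → ℂ} {κ : ℝ} (hF : IsPowerBounded F κ)
    (hG : IsPowerBounded G κ) : IsPowerBounded (fun c => F c + G c) κ := by
  obtain ⟨A, hA⟩ := hF
  obtain ⟨B, hB⟩ := hG
  refine ⟨A + B, fun c h0 h1 => ?_⟩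
  rw [add_mul]
  exact (norm_add_le _ _).trans (add_le_add (hA c h0 h1) (hB c h0 h1))

theorem IsPowerBounded.sum {ι : Type*} {s : Finset ι} {F : ι → ℝ → ℂ} {κ : ℝ}
    (hF : ∀ i ∈ s, IsPowerBounded (F i) κ) : IsPowerBounded (fun c => ∑ i ∈ s, F i c) κ := by
  classical
  induction s using Finset.induction_on with
  | empty => exact ⟨0, fun c _ _ => by simp⟩
  | insert i s hi ih =>
    simp only [Finset.sum_insert hi]
    exact (hF i (Finset.mem_insert_self i s)).add
      (ih fun j hj => hF j (Finset.mem_insert_of_mem hj))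

theorem IsPowerBounded.const_mul {F : ℝ → ℂ} {κ : ℝ} (hF : IsPowerBounded F κ) (z : ℂ) :
    IsPowerBounded (fun c => z * F c) κ := by
  obtain ⟨A, hA⟩ := hF
  refine ⟨‖z‖ * A, fun c h0 h1 => ?_⟩
  rw [norm_mul, mul_assoc]
  exact mul_le_mul_of_nonneg_left (hA c h0 h1) (norm_nonneg z)

theorem IsPowerBounded.mono {F : ℝ → ℂ} {κ κ' : ℝ} (hF : IsPowerBounded F κ) (h : κ' ≤ κ) :
    IsPowerBounded F κ' := by
  obtain ⟨A, hA⟩ := hF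
  refine ⟨max A 0, fun c h0 h1 => (hA c h0 h1).trans ?_⟩
  exact mul_le_mul (le_max_left _ _) (Real.rpow_le_rpow_of_exponent_ge h0 h1 h)
    (Real.rpow_nonneg h0.le _) (le_max_right _ _)

theorem IsPowerBounded.tendsto {F : ℝ → ℂ} {n : ℕ} {δ δ' : ℝ}
    (hF : IsPowerBounded F (n - δ')) (h : δ' < δ) :
    Tendsto (fun c : ℝ => c ^ δ • ((c ^ n)⁻¹ • F c)) (𝓝[>] 0) (𝓝 0) := by
  obtain ⟨A, hA⟩ := hF
  have h1 : Tendsto (fun c : ℝ => A * c ^ (δ - δ')) (𝓝[>] 0) (𝓝 0) := by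
    have h2 : Tendsto (fun c : ℝ => c ^ (δ - δ')) (𝓝[>] 0) (𝓝 0) := by
      have := (Real.continuousAt_rpow_const 0 (δ - δ') (Or.inr (sub_nonneg.2 h.le))).tendsto
      rw [Real.zero_rpow (sub_pos.2 h).ne'] at this
      exact this.mono_left nhdsWithin_le_nhds
    simpa using h2.const_mul A
  refine squeeze_zero_norm' ?_ h1
  filter_upwards [Ioc_mem_nhdsGT (zero_lt_one' ℝ)] with c hc
  have hc0 := hc.1
  rw [norm_smul, norm_smul, Real.norm_of_nonneg (Real.rpow_nonneg hc0.le _),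
    Real.norm_of_nonneg (by positivity)]
  calc c ^ δ * ((c ^ n)⁻¹ * ‖F c‖) ≤ c ^ δ * ((c ^ n)⁻¹ * (A * c ^ (n - δ'))) := by
        gcongr
        exact hA c hc0 hc.2
    _ = A * c ^ (δ - δ') := by
        rw [Real.rpow_sub hc0, Real.rpow_sub hc0, Real.rpow_natCast]
        field_simp

/-- A function on `(0, 1]` that is bounded away from `0` and becomes infinitesimal when multiplied
by `c ^ (δ - n)`, for some `δ < δ'`, is `O(c ^ (n - δ'))`. -/
theorem IsPowerBounded.of_tendsto {F : ℝ → ℂ} {n : ℕ} {δ δ' : ℝ}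
    (hF : Tendsto (fun c : ℝ => c ^ δ • ((c ^ n)⁻¹ • F c)) (𝓝[>] 0) (𝓝 0)) (h : δ ≤ δ')
    (hb : ∀ a : ℝ, 0 < a → ∃ C, ∀ c, a ≤ c → c ≤ 1 → ‖F c‖ ≤ C) :
    IsPowerBounded F (n - δ') := by
  refine IsPowerBounded.mono (κ := n - δ) ?_ (by linarith)
  have h1 := (tendsto_zero_iff_norm_tendsto_zero.1 hF).eventually_lt_const one_pos
  obtain ⟨b, hb0, h3⟩ := mem_nhdsGT_iff_exists_Ioo_subset.1 h1
  obtain ⟨C, hC⟩ := hb b hb0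
  obtain ⟨m, hm⟩ : ∃ m : ℝ, 0 < m ∧ ∀ c, b ≤ c → c ≤ 1 → m ≤ c ^ ((n : ℝ) - δ) := by
    rcases le_total 0 ((n : ℝ) - δ) with hk | hk
    · exact ⟨b ^ ((n : ℝ) - δ), Real.rpow_pos_of_pos hb0 _, fun c h4 _ =>
        Real.rpow_le_rpow (le_of_lt hb0) h4 hk⟩
    · exact ⟨1, one_pos, fun c h4 h5 =>
        Real.one_le_rpow_of_pos_of_le_one_of_nonpos (lt_of_lt_of_le hb0 h4) h5 hk⟩
  refine ⟨max 1 (|C| / m), fun c h0 h1 => ?_⟩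
  have hpos := Real.rpow_pos_of_pos h0 ((n : ℝ) - δ)
  rcases lt_or_ge c b with hcb | hcb
  · have h4 : ‖c ^ δ • ((c ^ n)⁻¹ • F c)‖ < 1 := h3 ⟨h0, hcb⟩
    rw [norm_smul, norm_smul, Real.norm_of_nonneg (Real.rpow_nonneg h0.le _),
      Real.norm_of_nonneg (by positivity)] at h4
    have h5 : ‖F c‖ = c ^ ((n : ℝ) - δ) * (c ^ δ * ((c ^ n)⁻¹ * ‖F c‖)) := by
      have := Real.rpow_pos_of_pos h0 δ
      rw [Real.rpow_sub h0, Real.rpow_natCast]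
      field_simp
    calc ‖F c‖ = c ^ ((n : ℝ) - δ) * (c ^ δ * ((c ^ n)⁻¹ * ‖F c‖)) := h5
      _ ≤ c ^ ((n : ℝ) - δ) * 1 := by gcongr
      _ ≤ max 1 (|C| / m) * c ^ ((n : ℝ) - δ) := by
        rw [mul_comm]
        gcongr
        exact le_max_left _ _
  · calc ‖F c‖ ≤ |C| := (hC c hcb h1).trans (le_abs_self C)
      _ = |C| / m * m := by rw [div_mul_cancel₀ _ hm.1.ne']
      _ ≤ max 1 (|C| / m) * c ^ ((n : ℝ) - δ) := by
        gcongr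
        · exact hm.1.le
        · exact le_max_right _ _
        · exact hm.2 c hcb h1

/-- The pairings of a distribution with the dilations `f (· / c)` are bounded as long as `c` stays
away from `0` and `∞`. -/
theorem exists_bound_dilate {U : Opens (Rn n)} (hU : IsScaleInvariant U)
    (T : 𝓓(U, ℝ) →L[ℝ] ℂ) (f : 𝓓(U, ℝ)) (a : ℝ) (ha : 0 < a) :
    ∃ C, ∀ c, a ≤ c → c ≤ 1 → ‖T (dilate hU c f)‖ ≤ C := by
  let K : Compacts (Rn n) := ⟨(fun p : ℝ × Rn n => p.1 • p.2) '' (Set.Icc a 1 ×ˢ tsupport f),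
    (isCompact_Icc.prod f.hasCompactSupport).image (by fun_prop)⟩
  have hK : (K : Set (Rn n)) ⊆ U := by
    rintro _ ⟨⟨c, x⟩, ⟨hc, hx⟩, rfl⟩
    exact hU c (ha.trans_le hc.1) x (f.tsupport_subset hx)
  have hfK : ∀ c : Set.Icc a 1, ∀ x ∉ K, dilate hU (c : ℝ) f x = 0 := by
    rintro ⟨c, hc⟩ x hx
    have hc0 : 0 < c := ha.trans_le hc.1
    rw [dilate_apply hU hc0]
    by_contra h0
    exact hx ⟨(c, c⁻¹ • x), ⟨hc, subset_tsupport f h0⟩, smul_inv_smul₀ hc0.ne' x⟩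
  have hf : ∀ j : ℕ, ∃ M, ∀ c : Set.Icc a 1, ∀ x ∈ K,
      ‖iteratedFDeriv ℝ j (dilate hU (c : ℝ) f) x‖ ≤ M := by
    intro j
    obtain ⟨M, hM⟩ := Continuous.bounded_above_of_compact_support
      (f.contDiff.continuous_iteratedFDeriv (m := j) (by exact_mod_cast le_top))
      (f.hasCompactSupport.iteratedFDeriv j)
    refine ⟨a⁻¹ ^ j * M, ?_⟩
    rintro ⟨c, hc⟩ x -
    have hc0 : 0 < c := ha.trans_le hc.1
    rw [iteratedFDeriv_dilate hU hc0, norm_smul, norm_pow,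
      Real.norm_of_nonneg (inv_nonneg.2 hc0.le)]
    have := hc.1
    gcongr
    exact hM _
  obtain ⟨C, hC⟩ := TestFunction.exists_bound_of_pointwise_bound (fun _ : Unit => T)
    (fun g => ⟨‖T g‖, fun _ => le_rfl⟩) K hK (fun c : Set.Icc a 1 => dilate hU (c : ℝ) f) hfK hf
  exact ⟨C, fun c h1 h2 => hC () ⟨c, h1, h2⟩⟩

/-- The scaling degree is less than `δ` only if `⟨t, f (· / c)⟩ = O(c ^ (n - δ))` for all `f`. -/
theorem isPowerBounded_of_scalingDegree_lt {U : Opens (Rn n)} (hU : IsScaleInvariant U)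
    (t : 𝓓'(U, ℂ)) {δ : ℝ} (h : scalingDegree hU t < δ) (f : 𝓓(U, ℝ)) :
    IsPowerBounded (fun c => t (dilate hU c f)) (n - δ) := by
  obtain ⟨_, ⟨δ', hδ', rfl⟩, hlt⟩ := sInf_lt_iff.1 h
  exact IsPowerBounded.of_tendsto (hδ' f) (EReal.coe_le_coe_iff.1 hlt.le)
    (fun a ha => exists_bound_dilate hU t f a ha)

/-- An infimum of exponents as in the definition of the scaling degree is bounded by `s` if power
bounds hold for all exponents beyond `s`. -/
theorem sInf_exponents_le {ι : Type*} {F : ι → ℝ → ℂ} {n : ℕ} {s : EReal}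
    (h : ∀ δ : ℝ, s < δ → ∀ i, IsPowerBounded (F i) (n - δ)) :
    sInf ((fun δ : ℝ => (δ : EReal)) '' {δ : ℝ | ∀ i,
      Tendsto (fun c : ℝ => c ^ δ • ((c ^ n)⁻¹ • F i c)) (𝓝[>] 0) (𝓝 0)}) ≤ s := by
  refine le_of_forall_gt_imp_ge_of_dense fun b hb => ?_
  obtain ⟨δ, hδ, hδb⟩ := EReal.lt_iff_exists_real_btwn.1 hb
  obtain ⟨δ', hδ', hδ'δ⟩ := EReal.lt_iff_exists_real_btwn.1 hδ
  have hmem : ∀ i, Tendsto (fun c : ℝ => c ^ δ • ((c ^ n)⁻¹ • F i c)) (𝓝[>] 0) (𝓝 0) :=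
    fun i => (h δ' hδ' i).tendsto (EReal.coe_lt_coe_iff.1 hδ'δ)
  refine le_trans (sInf_le ?_) hδb.le
  exact ⟨δ, hmem, rfl⟩

/-! ### Functions vanishing to high order at the origin -/

/-- Taylor estimate: if the derivatives of order less than `m` of a test function vanish at `0`,
then its `j`-th derivative is `O(‖y‖ ^ (m - j))`; the subtraction is truncated, so that derivatives
of order at least `m` are merely bounded. -/
theorem exists_bound_iteratedFDeriv_of_flat {E : Type*} [NormedAddCommGroup E] [NormedSpace ℝ E]
    {h : E → ℝ} (hh : ContDiff ℝ ((⊤ : ℕ∞) : WithTop ℕ∞) h) (hc : HasCompactSupport h) {m : ℕ}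
    (h0 : ∀ j < m, iteratedFDeriv ℝ j h 0 = 0) (j : ℕ) :
    ∃ C, 0 ≤ C ∧ ∀ y, ‖iteratedFDeriv ℝ j h y‖ ≤ C * ‖y‖ ^ (m - j) := by
  obtain ⟨d, hd⟩ : ∃ d, m - j = d := ⟨_, rfl⟩
  induction d generalizing j with
  | zero =>
    obtain ⟨M, hM⟩ := Continuous.bounded_above_of_compact_support
      (hh.continuous_iteratedFDeriv (m := j) (by exact_mod_cast le_top)) (hc.iteratedFDeriv j)
    exact ⟨M, (norm_nonneg _).trans (hM 0), fun y => by simpa [hd] using hM y⟩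
  | succ d ih =>
    obtain ⟨C, hC0, hC⟩ := ih (j + 1) (by omega)
    refine ⟨C, hC0, fun y => ?_⟩
    have hmv := Convex.norm_image_sub_le_of_norm_fderiv_le (𝕜 := ℝ)
      (f := iteratedFDeriv ℝ j h) (C := C * ‖y‖ ^ d) (s := Metric.closedBall 0 ‖y‖) (x := 0)
      (y := y)
      (fun x _ => (hh.differentiable_iteratedFDeriv (m := j)
        (by exact_mod_cast WithTop.coe_lt_top j)) x)
      (fun x hx => by
        rw [norm_fderiv_iteratedFDeriv]
        refine (hC x).trans ?_
        rw [show m - (j + 1) = d by omega]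
        gcongr
        simpa using hx)
      (convex_closedBall _ _) (by simp) (by simp)
    rw [h0 j (by omega), sub_zero, sub_zero] at hmv
    rwa [hd, pow_succ, ← mul_assoc]

/-- The basic estimate: on test functions concentrated at scale `ε c` that are, up to the dilation
by `c`, localizations of a function vanishing to order `m` at the origin. The dilations of `t₀` are
pointwise bounded after rescaling, the functions `ε ^ (-m) φ h (ε ·)` are bounded with all their
derivatives, and the uniform boundedness principle combines both. -/
theorem exists_bound_dilate_cutoff_dilate {n : ℕ} (t₀ : 𝓓'(punctured n, ℂ)) {δ : ℝ}
    (hδ : sdPunctured t₀ < δ) {φ : Rn n → ℝ} (hφ : IsCutoff φ) (hφc : HasCompactSupport φ)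
    (h : 𝓓((⊤ : Opens (Rn n)), ℝ)) {m : ℕ} (hm : ∀ j < m, iteratedFDeriv ℝ j h 0 = 0) :
    ∃ C, 0 ≤ C ∧ ∀ c ε : ℝ, 0 < c → c ≤ 1 → 0 < ε → ε ≤ 1 →
      ‖t₀ (dilate (isScaleInvariant_punctured n) c
        (cutoffCLM hφ (dilate (isScaleInvariant_top n) ε⁻¹ h)))‖ ≤
      C * (c ^ ((n : ℝ) - δ) * ε ^ m) := by
  let t : 𝓓(punctured n, ℝ) →L[ℝ] ℂ := t₀
  let T : Set.Ioc (0 : ℝ) 1 → 𝓓(punctured n, ℝ) →L[ℝ] ℂ := fun c =>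
    ((c : ℝ) ^ ((n : ℝ) - δ))⁻¹ • t.comp (dilateCLM (isScaleInvariant_punctured n) c)
  have hTf : ∀ c f, T c f = ((c : ℝ) ^ ((n : ℝ) - δ))⁻¹ •
      t (dilate (isScaleInvariant_punctured n) c f) := by
    intro c f
    rw [← dilateCLM_apply]
    rfl
  have hT : ∀ f, ∃ C, ∀ c, ‖T c f‖ ≤ C := by
    intro f
    obtain ⟨C, hC⟩ := isPowerBounded_of_scalingDegree_lt _ t₀ hδ f
    refine ⟨C, fun c => ?_⟩
    have hpos := Real.rpow_pos_of_pos c.2.1 ((n : ℝ) - δ)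
    rw [hTf, norm_smul, norm_inv, Real.norm_of_nonneg hpos.le, inv_mul_le_iff₀ hpos, mul_comm]
    exact hC c c.2.1 c.2.2
  let g : Set.Ioc (0 : ℝ) 1 → 𝓓((⊤ : Opens (Rn n)), ℝ) := fun ε =>
    ((ε : ℝ) ^ m)⁻¹ • dilate (isScaleInvariant_top n) (ε : ℝ)⁻¹ h
  let f : Set.Ioc (0 : ℝ) 1 → 𝓓(punctured n, ℝ) := fun ε => cutoffCLM hφ (g ε)
  let K : Compacts (Rn n) := ⟨tsupport φ, hφc⟩
  have hK : (K : Set (Rn n)) ⊆ punctured n := fun x hx h0 =>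
    hφ.zero_notMem ((h0 : x = 0) ▸ hx)
  have hfK : ∀ ε, ∀ x ∉ K, f ε x = 0 := by
    intro ε x hx
    rw [cutoffCLM_apply, image_eq_zero_of_notMem_tsupport (f := φ) hx, zero_mul]
  choose B hB0 hB using exists_bound_iteratedFDeriv_of_flat h.contDiff h.hasCompactSupport hm
  have hg : ∀ (j : ℕ) (ε : Set.Ioc (0 : ℝ) 1) (x : Rn n),
      ‖iteratedFDeriv ℝ j (g ε) x‖ ≤ B j * ‖x‖ ^ (m - j) := by
    rintro j ⟨ε, hε0, hε1⟩ x
    have h1 : iteratedFDeriv ℝ j (g ⟨ε, hε0, hε1⟩) x =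
        (ε ^ m)⁻¹ • iteratedFDeriv ℝ j (dilate (isScaleInvariant_top n) ε⁻¹ h) x :=
      iteratedFDeriv_const_smul_apply
        ((dilate (isScaleInvariant_top n) ε⁻¹ h).contDiff.contDiffAt.of_le
          (by exact_mod_cast le_top))
    rw [h1, iteratedFDeriv_dilate _ (inv_pos.2 hε0), norm_smul, norm_smul, inv_inv, norm_inv,
      norm_pow, norm_pow, Real.norm_of_nonneg hε0.le, inv_mul_le_iff₀ (by positivity)]
    calc ε ^ j * ‖iteratedFDeriv ℝ j h (ε • x)‖
        ≤ ε ^ j * (B j * ‖ε • x‖ ^ (m - j)) := by gcongr; exact hB j _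
      _ = ε ^ (j + (m - j)) * (B j * ‖x‖ ^ (m - j)) := by
        rw [norm_smul, Real.norm_of_nonneg hε0.le, mul_pow, pow_add]
        ring
      _ ≤ ε ^ m * (B j * ‖x‖ ^ (m - j)) :=
        mul_le_mul_of_nonneg_right (pow_le_pow_of_le_one hε0.le hε1 (by omega))
          (mul_nonneg (hB0 j) (by positivity))
  have hf : ∀ j : ℕ, ∃ M, ∀ ε, ∀ x ∈ K, ‖iteratedFDeriv ℝ j (f ε) x‖ ≤ M := by
    intro j
    have hcont : Continuous fun x : Rn n => ∑ i ∈ Finset.range (j + 1),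
        (j.choose i : ℝ) * ‖iteratedFDeriv ℝ i φ x‖ * (B (j - i) * ‖x‖ ^ (m - (j - i))) := by
      refine continuous_finsetSum _ fun i _ => ?_
      have := hφ.contDiff.continuous_iteratedFDeriv (m := i) (by exact_mod_cast le_top)
      fun_prop
    obtain ⟨M, hM⟩ := K.isCompact.exists_bound_of_continuousOn hcont.continuousOn
    refine ⟨M, fun ε x hx => ?_⟩
    have h1 : (f ε : Rn n → ℝ) = fun x => φ x * g ε x :=
      funext fun y => cutoffCLM_apply hφ (g ε) y
    rw [h1]
    refine (norm_iteratedFDeriv_mul_le hφ.contDiff (g ε).contDiff x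
      (by exact_mod_cast le_top)).trans (le_trans ?_ ((le_abs_self _).trans (hM x hx)))
    gcongr with i hi
    exact hg (j - i) ε x
  obtain ⟨C, hC⟩ := TestFunction.exists_bound_of_pointwise_bound T hT K hK f hfK hf
  refine ⟨max C 0, le_max_right _ _, fun c ε hc0 hc1 hε0 hε1 => ?_⟩
  have hpos := Real.rpow_pos_of_pos hc0 ((n : ℝ) - δ)
  have h1 : T ⟨c, hc0, hc1⟩ (f ⟨ε, hε0, hε1⟩) = (c ^ ((n : ℝ) - δ))⁻¹ • (ε ^ m)⁻¹ •
      t₀ (dilate (isScaleInvariant_punctured n) c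
        (cutoffCLM hφ (dilate (isScaleInvariant_top n) ε⁻¹ h))) := by
    have h3 : f ⟨ε, hε0, hε1⟩ = (ε ^ m)⁻¹ •
        cutoffCLM hφ (dilate (isScaleInvariant_top n) ε⁻¹ h) := map_smul _ _ _
    rw [hTf, h3, ← dilateCLM_apply (isScaleInvariant_punctured n), map_smul, map_smul,
      dilateCLM_apply]
    rfl
  have h2 := (hC ⟨c, hc0, hc1⟩ ⟨ε, hε0, hε1⟩).trans (le_max_left C 0)
  rw [h1, norm_smul, norm_smul, norm_inv, norm_inv, norm_pow, Real.norm_of_nonneg hpos.le,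
    Real.norm_of_nonneg hε0.le, inv_mul_le_iff₀ hpos, inv_mul_le_iff₀ (by positivity)] at h2
  linarith

/-! ### Jets at the origin -/

theorem lineDeriv_eq_fderiv {U : Opens (Rn n)} (v : Rn n) (f : 𝓓(U, ℝ)) (x : Rn n) :
    (∂_{v} f) x = fderiv ℝ f x v := by
  rw [lineDeriv_apply]
  exact ((f.contDiff.differentiable (by simp)) x).lineDeriv_eq_fderiv

theorem iteratedLineDeriv_eq_iteratedFDeriv {U : Opens (Rn n)} {k : ℕ} (v : Fin k → Rn n)
    (f : 𝓓(U, ℝ)) (x : Rn n) : (∂^{v} f) x = iteratedFDeriv ℝ k f x v := by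
  induction k generalizing x with
  | zero => simp
  | succ k ih =>
    rw [LineDeriv.iteratedLineDerivOp_succ_left, iteratedFDeriv_succ_apply_left,
      ← fderiv_continuousMultilinear_apply_const_apply, lineDeriv_eq_fderiv]
    · simp only [← ih]
    · exact f.contDiff.differentiable_iteratedFDeriv
        (by exact_mod_cast WithTop.coe_lt_top k) x

theorem lineDeriv_comm {U : Opens (Rn n)} (v w : Rn n) (f : 𝓓(U, ℝ)) :
    ∂_{v} (∂_{w} f) = ∂_{w} (∂_{v} f) := by
  have key : ∀ v w x, (∂_{v} (∂_{w} f)) x = fderiv ℝ (fderiv ℝ f) x v w := by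
    intro v w x
    have h1 : ⇑(∂_{w} f : 𝓓(U, ℝ)) = fun y => fderiv ℝ f y w :=
      funext fun y => lineDeriv_eq_fderiv w f y
    have h2 : DifferentiableAt ℝ (fderiv ℝ f) x :=
      (f.contDiff.fderiv_right (m := ((⊤ : ℕ∞) : WithTop ℕ∞)) (by simp)).differentiable
        (by simp) x
    rw [lineDeriv_eq_fderiv, h1, fderiv_clm_apply h2 (differentiableAt_const w)]
    simp
  ext x
  rw [key, key]
  exact (f.contDiff.contDiffAt.isSymmSndFDerivAt
    (by simpa using WithTop.coe_le_coe.2 (le_top : (2 : ℕ∞) ≤ ⊤))) v w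

theorem lineDeriv_iteratedLineDeriv_comm {U : Opens (Rn n)} (w : Rn n) {k : ℕ}
    (v : Fin k → Rn n) (f : 𝓓(U, ℝ)) : ∂_{w} (∂^{v} f) = ∂^{v} (∂_{w} f) := by
  induction k with
  | zero => simp
  | succ k ih =>
    rw [LineDeriv.iteratedLineDerivOp_succ_left, lineDeriv_comm, ih,
      LineDeriv.iteratedLineDerivOp_succ_left]

theorem iteratedLineDeriv_eq_foldr {U : Opens (Rn n)} {k : ℕ} (v : Fin k → Rn n) (f : 𝓓(U, ℝ)) :
    ∂^{v} f = (List.ofFn v).foldr (fun w g => ∂_{w} g) f := by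
  induction k with
  | zero => simp
  | succ k ih =>
    rw [LineDeriv.iteratedLineDerivOp_succ_left, ih, List.ofFn_succ, List.foldr_cons]
    rfl

/-- Iterated derivatives do not depend on the order of the directions. -/
theorem iteratedLineDeriv_comp_equiv {U : Opens (Rn n)} {j k : ℕ} (σ : Fin j ≃ Fin k)
    (v : Fin k → Rn n) (f : 𝓓(U, ℝ)) : ∂^{v ∘ σ} f = ∂^{v} f := by
  obtain rfl : j = k := by simpa using Fintype.card_congr σ
  rw [iteratedLineDeriv_eq_foldr, iteratedLineDeriv_eq_foldr]
  have : LeftCommutative (fun (w : Rn n) (g : 𝓓(U, ℝ)) => ∂_{w} g) :=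
    ⟨fun v w g => lineDeriv_comm v w g⟩
  exact (Equiv.Perm.ofFn_comp_perm σ v).foldr_eq f

/-- Every iterated partial derivative is `∂^α` for some multi-index `α`. -/
theorem exists_iteratedLineDeriv_eq_dirs {k : ℕ} (i : Fin k → Fin n) :
    ∃ α : Fin n → ℕ, ∑ a, α a = k ∧ ∀ {U : Opens (Rn n)} (f : 𝓓(U, ℝ)),
      ∂^{fun j => (EuclideanSpace.single (i j) (1 : ℝ) : Rn n)} f = ∂^{dirs α} f := by
  classical
  let α : Fin n → ℕ := fun a => Fintype.card {j // i j = a}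
  let σ : Fin (∑ a, α a) ≃ Fin k := finSigmaFinEquiv.symm.trans
    ((Equiv.sigmaCongrRight fun a => (Fintype.equivFin {j // i j = a}).symm).trans
      (Equiv.sigmaFiberEquiv i))
  refine ⟨α, by simpa using Fintype.card_congr σ, fun f => ?_⟩
  rw [← iteratedLineDeriv_comp_equiv σ]
  congr 1
  funext j
  have h : i (σ j) = (finSigmaFinEquiv.symm j).1 :=
    ((Fintype.equivFin {b // i b = (finSigmaFinEquiv.symm j).1}).symm
      (finSigmaFinEquiv.symm j).2).2
  simp only [Function.comp_apply, dirs, h]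

/-- A test function in `𝓓_l` has vanishing derivatives of every order `j ≤ l` at the origin. -/
theorem iteratedFDeriv_eq_zero_of_mem_flat {l : EReal} {g : 𝓓((⊤ : Opens (Rn n)), ℝ)}
    (hg : g ∈ flatSubmodule n l) {j : ℕ} (hj : ((j : ℝ) : EReal) ≤ l) :
    iteratedFDeriv ℝ j g 0 = 0 := by
  apply ContinuousMultilinearMap.toMultilinearMap_injective
  refine Module.Basis.ext_multilinear (fun _ => (EuclideanSpace.basisFun (Fin n) ℝ).toBasis)
    fun i => ?_
  obtain ⟨α, hα, h⟩ := exists_iteratedLineDeriv_eq_dirs i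
  have h1 := hg α (by rwa [OrderLE, hα])
  rw [← h, iteratedLineDeriv_eq_iteratedFDeriv] at h1
  simpa using h1

/-- The normalized monomial `x ^ α / α!`. -/
def monomialFun (α : Fin n → ℕ) (x : Rn n) : ℝ :=
  ∏ a, x a ^ α a / (α a).factorial

theorem contDiff_monomialFun (α : Fin n → ℕ) :
    ContDiff ℝ ((⊤ : ℕ∞) : WithTop ℕ∞) (monomialFun α) := by
  unfold monomialFun
  fun_prop

theorem lineDeriv_monomialFun (α : Fin n → ℕ) (b : Fin n) (x : Rn n) :
    lineDeriv ℝ (monomialFun α) x (EuclideanSpace.single b 1) =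
      if α b = 0 then 0 else monomialFun (α - Pi.single b 1) x := by
  have h1 : ∀ t : ℝ, monomialFun α (x + t • EuclideanSpace.single b (1 : ℝ)) =
      (x b + t) ^ α b / (α b).factorial *
        ∏ a ∈ Finset.univ.erase b, x a ^ α a / (α a).factorial := by
    intro t
    rw [monomialFun, ← Finset.mul_prod_erase _ _ (Finset.mem_univ b)]
    congr 1
    · simp
    · refine Finset.prod_congr rfl fun a ha => ?_
      simp [Finset.ne_of_mem_erase ha]
  have h2 : HasDerivAt (fun t : ℝ => (x b + t) ^ α b / (α b).factorial *
      ∏ a ∈ Finset.univ.erase b, x a ^ α a / (α a).factorial)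
      ((α b * (x b + 0) ^ (α b - 1) * 1) / (α b).factorial *
        ∏ a ∈ Finset.univ.erase b, x a ^ α a / (α a).factorial) 0 :=
    ((((hasDerivAt_id (0 : ℝ)).const_add (x b)).pow (α b)).div_const _).mul_const _
  rw [lineDeriv, funext h1, h2.deriv]
  split_ifs with h
  · simp [h]
  · rw [monomialFun, ← Finset.mul_prod_erase _ _ (Finset.mem_univ b)]
    congr 1
    · obtain ⟨k, hk⟩ := Nat.exists_eq_succ_of_ne_zero h
      simp only [hk, Pi.sub_apply, Pi.single_eq_same, Nat.succ_eq_add_one, Nat.add_sub_cancel,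
        Nat.factorial_succ]
      have := Nat.factorial_ne_zero k
      push_cast
      field_simp
      ring
    · refine Finset.prod_congr rfl fun a ha => ?_
      simp [Finset.ne_of_mem_erase ha]

theorem iteratedLineDeriv_apply_zero_of_eventuallyEq_zero {k : ℕ} (v : Fin k → Rn n)
    {f : 𝓓((⊤ : Opens (Rn n)), ℝ)} (hf : f =ᶠ[𝓝 0] fun _ => 0) : (∂^{v} f) 0 = 0 := by
  rw [iteratedLineDeriv_eq_iteratedFDeriv, (hf.iteratedFDeriv ℝ k).eq_of_nhds]
  simp

theorem iteratedLineDeriv_monomialFun {k : ℕ} (i : Fin k → Fin n) (α : Fin n → ℕ)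
    {f : 𝓓((⊤ : Opens (Rn n)), ℝ)} (hf : f =ᶠ[𝓝 0] monomialFun α) :
    (∂^{fun j => (EuclideanSpace.single (i j) (1 : ℝ) : Rn n)} f) 0 =
      if α = ∑ j, Pi.single (i j) 1 then 1 else 0 := by
  induction k generalizing f α with
  | zero =>
    rw [LineDeriv.iteratedLineDerivOp_fin_zero, hf.eq_of_nhds]
    simp only [Finset.univ_eq_empty, Finset.sum_empty]
    split_ifs with h
    · simp [monomialFun, h]
    · obtain ⟨a, ha⟩ := Function.ne_iff.1 h
      refine Finset.prod_eq_zero (Finset.mem_univ a) ?_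
      simp [show α a ≠ 0 from ha]
  | succ k ih =>
    rw [LineDeriv.iteratedLineDerivOp_succ_right]
    set b := i (Fin.last k) with hb
    have hd : ⇑(∂_{(EuclideanSpace.single b (1 : ℝ) : Rn n)} f : 𝓓((⊤ : Opens (Rn n)), ℝ)) =ᶠ[𝓝 0]
        fun x => if α b = 0 then 0 else monomialFun (α - Pi.single b 1) x := by
      filter_upwards [hf.eventuallyEq_nhds] with x hx
      rw [lineDeriv_apply, hx.lineDeriv_eq, lineDeriv_monomialFun]
    rw [Fin.sum_univ_castSucc, ← hb]
    by_cases h : α b = 0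
    · rw [iteratedLineDeriv_apply_zero_of_eventuallyEq_zero _ (by simpa [h] using hd), if_neg]
      intro h1
      have h2 := congrFun h1 b
      rw [h] at h2
      simp at h2
    · refine (ih (fun j => i j.castSucc) (α - Pi.single b 1) (by simpa [h] using hd)).trans ?_
      congr 1
      rw [eq_iff_iff]
      have hle : Pi.single b 1 ≤ α := by
        intro a
        by_cases hab : a = b
        · subst hab
          simpa using Nat.one_le_iff_ne_zero.2 h
        · simp [hab]
      exact tsub_eq_iff_eq_add_of_le hle

theorem sum_single_dirs (β : Fin n → ℕ) :
    ∑ j : Fin (∑ a, β a), Pi.single (finSigmaFinEquiv.symm j).1 1 = β := by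
  rw [← Equiv.sum_comp finSigmaFinEquiv]
  simp only [Equiv.symm_apply_apply]
  rw [Fintype.sum_sigma]
  funext b
  simp [Finset.sum_apply, Pi.single_apply]

/-- There are test functions `w_α` with `(∂^β w_α)(0) = δ_{αβ}`, namely the normalized monomials
multiplied by a bump function. -/
theorem exists_dual_jets (n : ℕ) : ∃ w : (Fin n → ℕ) → 𝓓((⊤ : Opens (Rn n)), ℝ),
    ∀ α β, (∂^{dirs β} (w α)) 0 = if α = β then 1 else 0 := by
  let χ : ContDiffBump (0 : Rn n) := ⟨1, 2, one_pos, one_lt_two⟩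
  refine ⟨fun α => ⟨fun x => χ x * monomialFun α x, χ.contDiff.mul (contDiff_monomialFun α),
    χ.hasCompactSupport.mul_right, Set.subset_univ _⟩, fun α β => ?_⟩
  have h := iteratedLineDeriv_monomialFun (fun j => (finSigmaFinEquiv (n := β).symm j).1) α
    (f := ⟨fun x => χ x * monomialFun α x, χ.contDiff.mul (contDiff_monomialFun α),
    χ.hasCompactSupport.mul_right, Set.subset_univ _⟩) (by
      filter_upwards [χ.eventuallyEq_one] with x hx
      change χ x * _ = _
      rw [hx]
      simp)
  rw [sum_single_dirs] at h
  exact h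

/-- The multi-indices of order less than `m`. -/
def multiIndices (n m : ℕ) : Finset (Fin n → ℕ) :=
  (Fintype.piFinset fun _ => Finset.range m).filter fun α => ∑ a, α a < m

theorem mem_multiIndices {m : ℕ} {α : Fin n → ℕ} : α ∈ multiIndices n m ↔ ∑ a, α a < m := by
  simp only [multiIndices, Finset.mem_filter, Fintype.mem_piFinset, Finset.mem_range,
    and_iff_right_iff_imp]
  exact fun h a => (Finset.single_le_sum (fun _ _ => Nat.zero_le _) (Finset.mem_univ a)).trans_lt h

/-- The derivative `f ↦ (∂^α f)(0)` as a continuous linear form. -/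
def jetCLM (α : Fin n → ℕ) : 𝓓((⊤ : Opens (Rn n)), ℝ) →L[ℝ] ℝ where
  toFun f := (∂^{dirs α} f) 0
  map_add' f g := by
    rw [LineDeriv.iteratedLineDerivOp_add]
    rfl
  map_smul' c f := by
    rw [LineDeriv.iteratedLineDerivOp_smul]
    rfl
  cont := (continuous_eval_const (0 : Rn n)).comp (LineDeriv.continuous_iteratedLineDerivOp _)

theorem jetCLM_apply (α : Fin n → ℕ) (f : 𝓓((⊤ : Opens (Rn n)), ℝ)) :
    jetCLM α f = (∂^{dirs α} f) 0 := rfl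

theorem jetCLM_dilate (α : Fin n → ℕ) {c : ℝ} (hc : 0 < c) (f : 𝓓((⊤ : Opens (Rn n)), ℝ)) :
    jetCLM α (dilate (isScaleInvariant_top n) c f) = c⁻¹ ^ (∑ a, α a) * jetCLM α f := by
  rw [jetCLM_apply, iteratedLineDeriv_dilate _ hc]
  change c⁻¹ ^ _ * (dilate (isScaleInvariant_top n) c (∂^{dirs α} f)) 0 = _
  rw [dilate_apply _ hc, smul_zero, jetCLM_apply]

theorem mem_flatSubmodule {l : EReal} {f : 𝓓((⊤ : Opens (Rn n)), ℝ)} :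
    f ∈ flatSubmodule n l ↔ ∀ α, OrderLE α l → jetCLM α f = 0 := Iff.rfl

theorem deltaDeriv_apply (α : Fin n → ℕ) (f : 𝓓((⊤ : Opens (Rn n)), ℝ)) :
    deltaDeriv α f = (-1) ^ (∑ a, α a) * (jetCLM α f : ℂ) := by
  have key : ∀ (k : ℕ) (v : Fin k → Rn n) (T : 𝓓'((⊤ : Opens (Rn n)), ℂ)),
      (∂^{v} T) f = (-1) ^ k * T (∂^{v} f) := by
    intro k
    induction k generalizing f with
    | zero => simp
    | succ k ih =>
      intro v T
      rw [LineDeriv.iteratedLineDerivOp_succ_left, LineDeriv.iteratedLineDerivOp_succ_left,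
        Distribution.lineDerivOp_apply_apply, map_neg, ih, lineDeriv_iteratedLineDeriv_comm,
        pow_succ]
      ring
  rw [deltaDeriv, key]
  rfl

/-- Test functions `w_α` dual to the jets at the origin. -/
def dualJet (α : Fin n → ℕ) : 𝓓((⊤ : Opens (Rn n)), ℝ) := (exists_dual_jets n).choose α

theorem jetCLM_dualJet (α β : Fin n → ℕ) : jetCLM β (dualJet α) = if α = β then 1 else 0 :=
  (exists_dual_jets n).choose_spec α β

/-- The projection `f ↦ f - ∑_{|α| < m} (∂^α f)(0) w_α`. -/
def flatProj (n m : ℕ) : 𝓓((⊤ : Opens (Rn n)), ℝ) →L[ℝ] 𝓓((⊤ : Opens (Rn n)), ℝ) :=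
  ContinuousLinearMap.id ℝ _ - ∑ α ∈ multiIndices n m, (jetCLM α).smulRight (dualJet α)

theorem flatProj_apply (m : ℕ) (f : 𝓓((⊤ : Opens (Rn n)), ℝ)) :
    flatProj n m f = f - ∑ α ∈ multiIndices n m, jetCLM α f • dualJet α := by
  simp [flatProj]

theorem flatProj_add_sum (m : ℕ) (f : 𝓓((⊤ : Opens (Rn n)), ℝ)) :
    flatProj n m f + ∑ α ∈ multiIndices n m, jetCLM α f • dualJet α = f := by
  rw [flatProj_apply, sub_add_cancel]

/-- `m` is the least natural number exceeding `l`, so that the condition `|α| ≤ l` reads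
`|α| < m`. -/
def IsOrderBound (l : EReal) (m : ℕ) : Prop := ∀ k : ℕ, ((k : ℝ) : EReal) ≤ l ↔ k < m

theorem IsOrderBound.orderLE_iff {l : EReal} {m : ℕ} (hl : IsOrderBound l m) {α : Fin n → ℕ} :
    OrderLE α l ↔ α ∈ multiIndices n m := by
  rw [OrderLE, hl, mem_multiIndices]

theorem exists_isOrderBound {l : EReal} (hl : l < ⊤) : ∃ m, IsOrderBound l m := by
  classical
  have hex : ∃ m : ℕ, l < ((m : ℝ) : EReal) := by
    obtain ⟨r, hr, -⟩ := EReal.lt_iff_exists_real_btwn.1 hl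
    obtain ⟨m, hm⟩ := exists_nat_gt r
    exact ⟨m, hr.trans (EReal.coe_lt_coe_iff.2 hm)⟩
  refine ⟨Nat.find hex, fun k => ⟨fun hk => ?_, fun hk => not_lt.1 (Nat.find_min hex hk)⟩⟩
  have h := hk.trans_lt (Nat.find_spec hex)
  exact_mod_cast EReal.coe_lt_coe_iff.1 h

theorem IsOrderBound.lt {l : EReal} {m : ℕ} (hl : IsOrderBound l m) : l < ((m : ℝ) : EReal) :=
  not_le.1 fun h => lt_irrefl _ ((hl m).1 h)

theorem lt_of_divDegree_lt {t₀ : 𝓓'(punctured n, ℂ)} {r : ℝ}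
    (h : divDegree t₀ < (r : EReal)) : sdPunctured t₀ < ((r + n : ℝ) : EReal) := by
  rw [divDegree] at h
  generalize sdPunctured t₀ = s at h ⊢
  induction s with
  | bot => exact EReal.bot_lt_coe _
  | coe s =>
    rw [← EReal.coe_sub, EReal.coe_lt_coe_iff] at h
    exact EReal.coe_lt_coe_iff.2 (by linarith)
  | top => exact absurd h (by rw [EReal.top_sub_coe]; exact not_lt.2 le_top)

theorem le_of_le_divDegree {t₀ : 𝓓'(punctured n, ℂ)} {r : ℝ}
    (h : (r : EReal) ≤ divDegree t₀) : ((r + n : ℝ) : EReal) ≤ sdPunctured t₀ := by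
  rw [divDegree] at h
  generalize sdPunctured t₀ = s at h ⊢
  induction s with
  | bot => simp at h
  | coe s =>
    rw [← EReal.coe_sub, EReal.coe_le_coe_iff] at h
    exact EReal.coe_le_coe_iff.2 (by linarith)
  | top => exact le_top

theorem divDegree_lt_top {t₀ : 𝓓'(punctured n, ℂ)} (h : sdPunctured t₀ < ⊤) :
    divDegree t₀ < ⊤ := by
  rw [divDegree]
  generalize sdPunctured t₀ = s at h ⊢
  induction s with
  | bot => simp
  | coe s => exact EReal.coe_lt_top _
  | top => exact absurd h (lt_irrefl _)

theorem flatProj_mem {l : EReal} {m : ℕ} (hl : IsOrderBound l m)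
    (f : 𝓓((⊤ : Opens (Rn n)), ℝ)) : flatProj n m f ∈ flatSubmodule n l := by
  rw [mem_flatSubmodule]
  intro β hβ
  rw [flatProj_apply, map_sub, map_sum]
  simp only [map_smul, jetCLM_dualJet, smul_eq_mul, mul_ite, mul_one, mul_zero]
  rw [Finset.sum_ite_eq' , if_pos (hl.orderLE_iff.1 hβ), sub_self]

theorem flatProj_eq_self {l : EReal} {m : ℕ} (hl : IsOrderBound l m)
    {g : 𝓓((⊤ : Opens (Rn n)), ℝ)} (hg : g ∈ flatSubmodule n l) : flatProj n m g = g := by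
  rw [flatProj_apply, Finset.sum_eq_zero, sub_zero]
  intro α hα
  rw [mem_flatSubmodule.1 hg α (hl.orderLE_iff.2 hα), zero_smul]

/-! ### The extension to functions vanishing to the order of divergence -/

/-- A smooth function that vanishes for `‖x‖ ≤ 1` and equals `1` for `‖x‖ ≥ 2`. -/
def outerCutoff (n : ℕ) (x : Rn n) : ℝ :=
  1 - (⟨1, 2, one_pos, one_lt_two⟩ : ContDiffBump (0 : Rn n)) x

theorem isCutoff_outerCutoff (n : ℕ) : IsCutoff (outerCutoff n) := by
  refine ⟨contDiff_const.sub (ContDiffBump.contDiff _), ?_⟩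
  rw [notMem_tsupport_iff_eventuallyEq]
  filter_upwards [(⟨1, 2, one_pos, one_lt_two⟩ :
    ContDiffBump (0 : Rn n)).eventuallyEq_one] with x hx
  rw [outerCutoff, hx]
  simp

theorem outerCutoff_eq_one {x : Rn n} (hx : 2 ≤ ‖x‖) : outerCutoff n x = 1 := by
  rw [outerCutoff, ContDiffBump.zero_of_le_dist _ (by simpa using hx), sub_zero]

theorem hasCompactSupport_outerCutoff_sub {c : ℝ} (hc : c ≠ 0) :
    HasCompactSupport fun x => outerCutoff n (c⁻¹ • x) - outerCutoff n x := by
  let χ : ContDiffBump (0 : Rn n) := ⟨1, 2, one_pos, one_lt_two⟩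
  have h : (fun x => outerCutoff n (c⁻¹ • x) - outerCutoff n x) =
      fun x => χ x - χ (c⁻¹ • x) := by
    funext x
    simp only [outerCutoff]
    ring
  rw [h]
  exact χ.hasCompactSupport.sub
    (χ.hasCompactSupport.comp_homeomorph (Homeomorph.smulOfNeZero c⁻¹ (inv_ne_zero hc)))

/-- The function `outerCutoff` at scale `c`. -/
theorem isCutoff_outerCutoff_smul (n : ℕ) {c : ℝ} (hc : c ≠ 0) :
    IsCutoff fun x => outerCutoff n (c⁻¹ • x) :=
  (isCutoff_outerCutoff n).comp_smul hc

theorem cutoffCLM_sub_cutoffCLM {a b φ : Rn n → ℝ} (ha : IsCutoff a) (hb : IsCutoff b)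
    (hφ : IsCutoff φ) {ε : ℝ} (hε : 0 < ε) (h : ∀ x, a x - b x = φ (ε⁻¹ • x))
    (g : 𝓓((⊤ : Opens (Rn n)), ℝ)) :
    cutoffCLM ha g - cutoffCLM hb g = dilate (isScaleInvariant_punctured n) ε
      (cutoffCLM hφ (dilate (isScaleInvariant_top n) ε⁻¹ g)) := by
  ext x
  rw [dilate_apply _ hε, cutoffCLM_apply, dilate_apply _ (inv_pos.2 hε), inv_inv,
    smul_inv_smul₀ hε.ne', ← h, sub_mul, ← cutoffCLM_apply ha, ← cutoffCLM_apply hb]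
  rfl

theorem dilate_cutoffCLM {a b : Rn n → ℝ} (ha : IsCutoff a) (hb : IsCutoff b) {c : ℝ}
    (hc : 0 < c) (h : ∀ x, b x = a (c⁻¹ • x)) (g : 𝓓((⊤ : Opens (Rn n)), ℝ)) :
    dilate (isScaleInvariant_punctured n) c (cutoffCLM ha g) =
      cutoffCLM hb (dilate (isScaleInvariant_top n) c g) := by
  ext x
  rw [dilate_apply _ hc, cutoffCLM_apply, cutoffCLM_apply, dilate_apply _ hc, h]

/-- Removal of the ball of radius `2⁻ᵏ` around the origin from the support of a test function. -/
def dyadicCut (n k : ℕ) : 𝓓((⊤ : Opens (Rn n)), ℝ) →L[ℝ] 𝓓(punctured n, ℝ) :=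
  cutoffCLM (isCutoff_outerCutoff_smul n (c := (1 / 2) ^ k) (by positivity))

/-- Successive truncations of a function vanishing to order `m` differ by terms that decay
geometrically, uniformly under dilations. -/
theorem exists_bound_dyadicCut_succ_sub (t₀ : 𝓓'(punctured n, ℂ)) {δ : ℝ}
    (hδ : sdPunctured t₀ < δ) (g : 𝓓((⊤ : Opens (Rn n)), ℝ)) {m : ℕ}
    (hm : ∀ j < m, iteratedFDeriv ℝ j g 0 = 0) :
    ∃ C, 0 ≤ C ∧ ∀ c : ℝ, 0 < c → c ≤ 1 → ∀ k : ℕ,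
      dist (t₀ (dilate (isScaleInvariant_punctured n) c (dyadicCut n k g)))
        (t₀ (dilate (isScaleInvariant_punctured n) c (dyadicCut n (k + 1) g))) ≤
        C * c ^ ((n : ℝ) - δ) * ((1 / 2 : ℝ) ^ ((n : ℝ) - δ + m)) ^ k := by
  obtain ⟨C, hC0, hC⟩ := exists_bound_dilate_cutoff_dilate t₀ hδ
    ((isCutoff_outerCutoff_smul n (c := 1 / 2) (by norm_num)).sub (isCutoff_outerCutoff n))
    (hasCompactSupport_outerCutoff_sub (by norm_num)) g hm
  refine ⟨C, hC0, fun c hc0 hc1 k => ?_⟩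
  have hε : (0 : ℝ) < (1 / 2) ^ k := by positivity
  have hε1 : ((1 : ℝ) / 2) ^ k ≤ 1 := pow_le_one₀ (by norm_num) (by norm_num)
  have h1 := cutoffCLM_sub_cutoffCLM
    (isCutoff_outerCutoff_smul n (c := (1 / 2) ^ (k + 1)) (by positivity))
    (isCutoff_outerCutoff_smul n (c := (1 / 2) ^ k) (by positivity))
    ((isCutoff_outerCutoff_smul n (c := 1 / 2) (by norm_num)).sub (isCutoff_outerCutoff n))
    hε (fun x => by rw [smul_smul, pow_succ, mul_inv, mul_comm]) g
  have h2 := hC (c * (1 / 2) ^ k) ((1 / 2) ^ k) (by positivity)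
    (mul_le_one₀ hc1 hε.le hε1) hε hε1
  rw [← dilate_dilate _ hc0 hε, ← h1, ← dilateCLM_apply, map_sub, map_sub, dilateCLM_apply,
    dilateCLM_apply] at h2
  rw [dist_comm, dist_eq_norm]
  refine h2.trans (le_of_eq ?_)
  rw [Real.mul_rpow hc0.le hε.le, mul_assoc, mul_assoc, ← Real.rpow_natCast (_ ^ (_ + _)),
    ← Real.rpow_natCast (1 / 2 : ℝ) k, ← Real.rpow_mul (by norm_num), ← Real.rpow_mul (by norm_num),
    ← Real.rpow_natCast ((1 / 2 : ℝ) ^ (k : ℝ)), ← Real.rpow_mul (by norm_num),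
    ← Real.rpow_add (by norm_num)]
  ring_nf

/-- The extension of `t₀` to `𝓓_l`, realized on all test functions by means of the projection
onto `𝓓_l`, that is, as a distribution vanishing on the dual test functions `w_α`: it is the limit of
the truncations of `t₀`, and it scales like `t₀` on `𝓓_l`. -/
theorem exists_flat_extension (t₀ : 𝓓'(punctured n, ℂ)) {m : ℕ}
    (hl : IsOrderBound (divDegree t₀) m) :
    ∃ T : 𝓓((⊤ : Opens (Rn n)), ℝ) →L[ℝ] ℂ, (∀ f, T (incl f) = t₀ f) ∧
      (∀ α ∈ multiIndices n m, T (dualJet α) = 0) ∧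
      ∀ g ∈ flatSubmodule n (divDegree t₀), ∀ δ : ℝ, sdPunctured t₀ < δ →
        IsPowerBounded (fun c => T (dilate (isScaleInvariant_top n) c g)) (n - δ) := by
  let t : 𝓓(punctured n, ℝ) →L[ℝ] ℂ := t₀
  have hsd : sdPunctured t₀ < ((m + n : ℝ) : EReal) := lt_of_divDegree_lt hl.lt
  have hflat : ∀ g ∈ flatSubmodule n (divDegree t₀), ∀ j < m, iteratedFDeriv ℝ j g 0 = 0 :=
    fun g hg j hj => iteratedFDeriv_eq_zero_of_mem_flat hg ((hl j).2 hj)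
  have hr : ∀ δ : ℝ, δ < m + n → (1 / 2 : ℝ) ^ ((n : ℝ) - δ + m) < 1 := fun δ hδ =>
    Real.rpow_lt_one (by norm_num) (by norm_num) (by linarith)
  have hconv : ∀ g ∈ flatSubmodule n (divDegree t₀),
      ∃ z, Tendsto (fun k => t (dyadicCut n k g)) atTop (𝓝 z) := by
    intro g hg
    obtain ⟨δ, hδ, hδm⟩ := EReal.lt_iff_exists_real_btwn.1 hsd
    obtain ⟨C, -, hC⟩ := exists_bound_dyadicCut_succ_sub t₀ hδ g (hflat g hg)
    refine cauchySeq_tendsto_of_complete (cauchySeq_of_le_geometric _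
      (C * 1 ^ ((n : ℝ) - δ)) (hr δ (EReal.coe_lt_coe_iff.1 hδm)) fun k => ?_)
    have := hC 1 one_pos le_rfl k
    rwa [dilate_one, dilate_one] at this
  obtain ⟨T, hT⟩ := TestFunction.exists_clm_of_tendsto
    (fun k => t.comp ((dyadicCut n k).comp (flatProj n m)))
    (fun f => hconv _ (flatProj_mem hl f))
  have hTflat : ∀ g ∈ flatSubmodule n (divDegree t₀),
      Tendsto (fun k => t (dyadicCut n k g)) atTop (𝓝 (T g)) := by
    intro g hg
    have := hT g
    simp only [ContinuousLinearMap.comp_apply, flatProj_eq_self hl hg] at this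
    exact this
  refine ⟨T, fun f => ?_, fun α hα => ?_, fun g hg δ hδ => ?_⟩
  · refine tendsto_nhds_unique (hTflat _ (incl_mem_flat _ f)) (tendsto_const_nhds.congr' ?_)
    have h0 : (0 : Rn n) ∉ tsupport f := fun h => f.tsupport_subset h rfl
    obtain ⟨r, hr0, hball⟩ := Metric.eventually_nhds_iff.1
      (notMem_tsupport_iff_eventuallyEq.1 h0)
    have hlim : Tendsto (fun k : ℕ => 2 * (1 / 2 : ℝ) ^ k) atTop (𝓝 0) := by
      simpa using (tendsto_pow_atTop_nhds_zero_of_lt_one (r := (1 / 2 : ℝ)) (by norm_num)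
        (by norm_num)).const_mul 2
    filter_upwards [hlim.eventually_lt_const hr0] with k hk
    change t f = _
    congr 1
    ext x
    rw [dyadicCut, cutoffCLM_apply, incl_apply]
    rcases lt_or_ge (dist x 0) r with hx | hx
    · rw [show f x = 0 from hball hx, mul_zero]
    · rw [outerCutoff_eq_one, one_mul]
      rw [norm_smul, norm_inv, Real.norm_of_nonneg (by positivity), inv_mul_eq_div,
        le_div_iff₀ (by positivity)]
      rw [dist_zero_right] at hx
      linarith
  · refine tendsto_nhds_unique (hT _) ?_
    have h0 : flatProj n m (dualJet α) = 0 := by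
      rw [flatProj_apply]
      simp only [jetCLM_dualJet, ite_smul, one_smul, zero_smul]
      rw [Finset.sum_ite_eq, if_pos hα, sub_self]
    simp [h0]
  · -- The geometric series converges only for exponents below `m + n`.
    obtain ⟨δ', hδ', hlt⟩ := EReal.lt_iff_exists_real_btwn.1 (lt_min hδ hsd)
    have hδ'δ : δ' < δ := EReal.coe_lt_coe_iff.1 (hlt.trans_le (min_le_left _ _))
    have hδ'm : δ' < m + n := EReal.coe_lt_coe_iff.1 (hlt.trans_le (min_le_right _ _))
    refine IsPowerBounded.mono (κ := n - δ') ?_ (by linarith)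
    obtain ⟨C, hC0, hC⟩ := exists_bound_dyadicCut_succ_sub t₀ hδ' g (hflat g hg)
    obtain ⟨A, hA⟩ := isPowerBounded_of_scalingDegree_lt _ t₀ hδ' (dyadicCut n 0 g)
    set r : ℝ := (1 / 2 : ℝ) ^ ((n : ℝ) - δ' + m) with hrdef
    have hr1 : r < 1 := hr δ' hδ'm
    refine ⟨C / (1 - r) + A, fun c hc0 hc1 => ?_⟩
    -- Truncation and dilation commute up to terms that vanish in the limit.
    have hlim : Tendsto (fun k => t₀ (dilate (isScaleInvariant_punctured n) c
        (dyadicCut n k g))) atTop (𝓝 (T (dilate (isScaleInvariant_top n) c g))) := by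
      have hgc := dilate_mem_flat c hg
      obtain ⟨B, -, hB⟩ := exists_bound_dilate_cutoff_dilate t₀ hδ'
        ((isCutoff_outerCutoff_smul n hc0.ne').sub (isCutoff_outerCutoff n))
        (hasCompactSupport_outerCutoff_sub hc0.ne') _ (hflat _ hgc)
      have hz : Tendsto (fun k => t (dilate (isScaleInvariant_punctured n) c (dyadicCut n k g)) -
          t (dyadicCut n k (dilate (isScaleInvariant_top n) c g))) atTop (𝓝 0) := by
        have hgeo : Tendsto (fun k : ℕ => B * r ^ k) atTop (𝓝 0) := by
          have := (tendsto_pow_atTop_nhds_zero_of_lt_one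
            (Real.rpow_nonneg (by norm_num) _) hr1).const_mul B
          rwa [mul_zero] at this
        refine squeeze_zero_norm (fun k => ?_) hgeo
        have hε : (0 : ℝ) < (1 / 2) ^ k := by positivity
        have hε1 : ((1 : ℝ) / 2) ^ k ≤ 1 := pow_le_one₀ (by norm_num) (by norm_num)
        have hcε : c * (1 / 2) ^ k ≠ 0 := (mul_pos hc0 hε).ne'
        rw [dyadicCut, dilate_cutoffCLM _ (isCutoff_outerCutoff_smul n hcε) hc0
          (fun x => by rw [smul_smul, mul_inv, mul_comm]), ← map_sub,
          cutoffCLM_sub_cutoffCLM _ _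
            ((isCutoff_outerCutoff_smul n hc0.ne').sub (isCutoff_outerCutoff n)) hε
            (fun x => by rw [smul_smul, mul_inv])]
        refine (hB _ _ hε hε1 hε hε1).trans (le_of_eq ?_)
        rw [hrdef, ← Real.rpow_natCast (_ ^ (_ + _)), ← Real.rpow_natCast (1 / 2 : ℝ) k,
          ← Real.rpow_mul (by norm_num), ← Real.rpow_mul (by norm_num),
          ← Real.rpow_natCast ((1 / 2 : ℝ) ^ (k : ℝ)), ← Real.rpow_mul (by norm_num),
          ← Real.rpow_add (by norm_num)]
        ring_nf
      have := hz.add (hTflat _ hgc)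
      simp only [sub_add_cancel, zero_add] at this
      exact this
    have hdist := dist_le_of_le_geometric_of_tendsto₀ r (C * c ^ ((n : ℝ) - δ')) hr1
      (fun k => hC c hc0 hc1 k) hlim
    have hA' := hA c hc0 hc1
    rw [dist_comm, dist_eq_norm] at hdist
    calc ‖T (dilate (isScaleInvariant_top n) c g)‖
        ≤ ‖T (dilate (isScaleInvariant_top n) c g) -
            t₀ (dilate (isScaleInvariant_punctured n) c (dyadicCut n 0 g))‖ +
          ‖t₀ (dilate (isScaleInvariant_punctured n) c (dyadicCut n 0 g))‖ := norm_le_norm_sub_add _ _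
      _ ≤ C * c ^ ((n : ℝ) - δ') / (1 - r) + A * c ^ ((n : ℝ) - δ') := add_le_add hdist hA'
      _ = (C / (1 - r) + A) * c ^ ((n : ℝ) - δ') := by ring

/-! ### The scaling degree of extensions to all test functions -/

/-- A function on `(0, 1]` that satisfies a contractive inequality under halving of the argument
is bounded. -/
theorem exists_bound_of_halving {A : ℝ → ℝ} {M q E : ℝ} (hq0 : 0 ≤ q) (hq1 : q < 1)
    (hM : ∀ c, 1 / 2 ≤ c → c ≤ 1 → A c ≤ M)
    (h : ∀ c, 0 < c → c ≤ 1 → A (1 / 2 * c) ≤ q * A c + E) :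
    ∃ B, ∀ c, 0 < c → c ≤ 1 → A c ≤ B := by
  have hq : 0 < 1 - q := sub_pos.2 hq1
  refine ⟨max M (E / (1 - q)), fun c hc0 hc1 => ?_⟩
  have hB : q * max M (E / (1 - q)) + E ≤ max M (E / (1 - q)) := by
    have := (div_le_iff₀ hq).1 (le_max_right M (E / (1 - q)))
    linarith
  have key : ∀ k : ℕ, ∀ c : ℝ, (1 / 2) ^ (k + 1) ≤ c → c ≤ 1 → A c ≤ max M (E / (1 - q)) := by
    intro k
    induction k with
    | zero => exact fun c h0 h1 => (hM c (by simpa using h0) h1).trans (le_max_left _ _)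
    | succ k ih =>
      intro c h0 h1
      rcases le_total (1 / 2) c with h2 | h2
      · exact (hM c h2 h1).trans (le_max_left _ _)
      · have h3 : (0 : ℝ) < (1 / 2) ^ (k + 1) := by positivity
        have h4 : (1 / 2 : ℝ) ^ (k + 1) ≤ 2 * c := by
          rw [pow_succ] at h0
          linarith
        have h5 := h (2 * c) (by linarith) (by linarith)
        rw [← mul_assoc, one_div, inv_mul_cancel₀ two_ne_zero, one_mul] at h5
        exact h5.trans (le_trans (by gcongr; exact ih _ h4 (by linarith)) hB)
  obtain ⟨k, hk⟩ := exists_pow_lt_of_lt_one hc0 (by norm_num : (1 / 2 : ℝ) < 1)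
  refine key k c (le_trans ?_ hk.le) hc1
  exact pow_le_pow_of_le_one (by norm_num) (by norm_num) (Nat.le_succ k)

/-- The dual test functions `w_α` are homogeneous of degree `-|α|` up to functions vanishing to the
order of divergence. -/
theorem dilate_dualJet_sub_mem {l : EReal} (α : Fin n → ℕ) {c : ℝ} (hc : 0 < c) :
    dilate (isScaleInvariant_top n) c (dualJet α) - c⁻¹ ^ (∑ a, α a) • dualJet α ∈
      flatSubmodule n l := by
  rw [mem_flatSubmodule]
  intro β _
  rw [map_sub, map_smul, jetCLM_dilate β hc, jetCLM_dualJet]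
  split_ifs with h
  · rw [h]
    simp
  · simp

/-- An extension of `t₀` that scales like `t₀` on `𝓓_l` scales like `t₀` on the dual test functions
`w_α`, because `|α| ≤ sd t₀ - n`. -/
theorem isPowerBounded_dualJet {t₀ : 𝓓'(punctured n, ℂ)} (S : 𝓓((⊤ : Opens (Rn n)), ℝ) →L[ℝ] ℂ)
    (hS : ∀ g ∈ flatSubmodule n (divDegree t₀), ∀ δ : ℝ, sdPunctured t₀ < δ →
      IsPowerBounded (fun c => S (dilate (isScaleInvariant_top n) c g)) (n - δ))
    {α : Fin n → ℕ} (hα : OrderLE α (divDegree t₀)) {δ : ℝ} (hδ : sdPunctured t₀ < δ) :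
    IsPowerBounded (fun c => S (dilate (isScaleInvariant_top n) c (dualJet α))) (n - δ) := by
  set N := ∑ a, α a with hN
  have hκ : (N : ℝ) + n < δ := EReal.coe_lt_coe_iff.1 ((le_of_le_divDegree hα).trans_lt hδ)
  -- Up to `v ∈ 𝓓_l`, halving the scale multiplies `w_α` by `2 ^ |α|`.
  set v := dilate (isScaleInvariant_top n) (1 / 2) (dualJet α) -
    (1 / 2 : ℝ)⁻¹ ^ N • dualJet α with hv
  obtain ⟨E, hE⟩ := hS v (dilate_dualJet_sub_mem α (by norm_num)) δ hδ
  obtain ⟨M, hM⟩ := exists_bound_dilate (isScaleInvariant_top n) S (dualJet α) (1 / 2)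
    (by norm_num)
  have hstep : ∀ c : ℝ, 0 < c → S (dilate (isScaleInvariant_top n) (1 / 2 * c) (dualJet α)) =
      (2 : ℝ) ^ N • S (dilate (isScaleInvariant_top n) c (dualJet α)) +
        S (dilate (isScaleInvariant_top n) c v) := by
    intro c hc
    have h1 : dilate (isScaleInvariant_top n) (1 / 2) (dualJet α) =
        (2 : ℝ) ^ N • dualJet α + v := by
      rw [hv, one_div, inv_inv]
      abel
    rw [mul_comm, ← dilate_dilate _ hc (by norm_num), h1, ← dilateCLM_apply, map_add, map_smul,
      map_add, map_smul, dilateCLM_apply, dilateCLM_apply]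
  -- The quantity to be bounded is `c ^ (δ - n) ‖S (w_α (· / c))‖`.
  obtain ⟨B, hB⟩ := exists_bound_of_halving
    (A := fun c => (c ^ ((n : ℝ) - δ))⁻¹ *
      ‖S (dilate (isScaleInvariant_top n) c (dualJet α))‖)
    (M := |M|) (q := (1 / 2 : ℝ) ^ (δ - n - N)) (E := (1 / 2 : ℝ) ^ (δ - n) * E)
    (Real.rpow_nonneg (by norm_num) _)
    (Real.rpow_lt_one (by norm_num) (by norm_num) (by linarith))
    (fun c h1 h2 => by
      have h3 := Real.one_le_rpow_of_pos_of_le_one_of_nonpos (by linarith : 0 < c) h2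
        (by linarith [(Nat.cast_nonneg N : (0 : ℝ) ≤ N)] : (n : ℝ) - δ ≤ 0)
      calc _ ≤ 1 * |M| := by
            gcongr
            · exact inv_le_one_of_one_le₀ h3
            · exact (hM c h1 h2).trans (le_abs_self M)
        _ = |M| := one_mul _)
    (fun c h1 h2 => by
      have hpos := Real.rpow_pos_of_pos h1 ((n : ℝ) - δ)
      have h3 := hE c h1 h2
      have h4 : ((1 / 2 * c) ^ ((n : ℝ) - δ))⁻¹ =
          (1 / 2 : ℝ) ^ (δ - n) * (c ^ ((n : ℝ) - δ))⁻¹ := by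
        rw [Real.mul_rpow (by norm_num) h1.le, mul_inv, ← Real.rpow_neg (by norm_num), neg_sub]
      have h5 : (1 / 2 : ℝ) ^ (δ - n - N) = (1 / 2 : ℝ) ^ (δ - n) * 2 ^ N := by
        rw [Real.rpow_sub (by norm_num), Real.rpow_natCast, one_div, inv_pow, div_inv_eq_mul]
      have h6 : (0 : ℝ) < (1 / 2 : ℝ) ^ (δ - n) := Real.rpow_pos_of_pos (by norm_num) _
      rw [h4, h5, hstep c h1]
      calc _ ≤ (1 / 2 : ℝ) ^ (δ - n) * (c ^ ((n : ℝ) - δ))⁻¹ *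
            (2 ^ N * ‖S (dilate (isScaleInvariant_top n) c (dualJet α))‖ +
              E * c ^ ((n : ℝ) - δ)) := by
            gcongr
            refine (norm_add_le _ _).trans (add_le_add (le_of_eq ?_) h3)
            rw [norm_smul, Real.norm_of_nonneg (by positivity)]
        _ = _ := by field_simp)
  refine ⟨B, fun c h1 h2 => ?_⟩
  have h3 := hB c h1 h2
  have hpos := Real.rpow_pos_of_pos h1 ((n : ℝ) - δ)
  rwa [inv_mul_le_iff₀ hpos, mul_comm] at h3

theorem dilate_eq_flatProj_add (m : ℕ) (c : ℝ) (f : 𝓓((⊤ : Opens (Rn n)), ℝ)) :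
    dilate (isScaleInvariant_top n) c f =
      dilate (isScaleInvariant_top n) c (flatProj n m f) +
        ∑ α ∈ multiIndices n m, jetCLM α f • dilate (isScaleInvariant_top n) c (dualJet α) := by
  conv_lhs => rw [← flatProj_add_sum m f, ← dilateCLM_apply]
  simp only [map_add, map_sum, map_smul, dilateCLM_apply]

/-- An extension of `t₀` that scales like `t₀` on `𝓓_l` has the scaling degree of `t₀`. -/
theorem sdWhole_eq_of_isPowerBounded {t₀ : 𝓓'(punctured n, ℂ)} (hsd : sdPunctured t₀ < ⊤)
    (S : 𝓓'((⊤ : Opens (Rn n)), ℂ)) (hext : IsExtension S t₀)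
    (hS : ∀ g ∈ flatSubmodule n (divDegree t₀), ∀ δ : ℝ, sdPunctured t₀ < δ →
      IsPowerBounded (fun c => S (dilate (isScaleInvariant_top n) c g)) (n - δ)) :
    sdWhole S = sdPunctured t₀ := by
  let S' : 𝓓((⊤ : Opens (Rn n)), ℝ) →L[ℝ] ℂ := S
  obtain ⟨m, hl⟩ := exists_isOrderBound (divDegree_lt_top hsd)
  refine le_antisymm ?_ ?_
  · refine sInf_exponents_le
      (F := fun (f : 𝓓((⊤ : Opens (Rn n)), ℝ)) c => S' (dilate (isScaleInvariant_top n) c f))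
      fun δ hδ f => ?_
    simp_rw [dilate_eq_flatProj_add m _ f, map_add, map_sum, map_smul]
    refine (hS _ (flatProj_mem hl f) δ hδ).add (IsPowerBounded.sum fun α hα => ?_)
    simp_rw [Complex.real_smul]
    exact (isPowerBounded_dualJet S' hS (hl.orderLE_iff.2 hα) hδ).const_mul _
  · refine sInf_le_sInf (Set.image_mono fun δ hδ f => ?_)
    refine (hδ (incl f)).congr fun c => ?_
    rw [scaledPairing, scaledPairing, dilate_incl, hext]

/-- The restriction to `𝓓_l` of an extension of `t₀` that scales like `t₀` on `𝓓_l`. -/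
theorem isFlatExtension_restrict {t₀ : 𝓓'(punctured n, ℂ)}
    (T : 𝓓((⊤ : Opens (Rn n)), ℝ) →L[ℝ] ℂ) (hext : ∀ f, T (incl f) = t₀ f)
    (hT : ∀ g ∈ flatSubmodule n (divDegree t₀), ∀ δ : ℝ, sdPunctured t₀ < δ →
      IsPowerBounded (fun c => T (dilate (isScaleInvariant_top n) c g)) (n - δ)) :
    IsFlatExtension t₀ (T.comp (flatSubmodule n (divDegree t₀)).subtypeL) := by
  refine ⟨hext, le_antisymm ?_ ?_⟩
  · exact sInf_exponents_le
      (F := fun (g : flatSubmodule n (divDegree t₀)) c =>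
        T (dilate (isScaleInvariant_top n) c g)) fun δ hδ g => hT g g.2 δ hδ
  · refine sInf_le_sInf (Set.image_mono fun δ hδ f => ?_)
    refine (hδ ⟨incl f, incl_mem_flat _ f⟩).congr fun c => ?_
    have h : T (dilate (isScaleInvariant_top n) c (incl f)) =
        t₀ (dilate (isScaleInvariant_punctured n) c f) := by
      rw [dilate_incl, hext]
    rw [scaledPairing, ← h]
    rfl

/-! ### Principal parts -/

theorem IsPrincipalPoly.congr {F G : ℂ → ℂ} {p : ℂ[X]} (hF : IsPrincipalPoly F p)
    (h : ∀ ζ, G ζ = F ζ) : IsPrincipalPoly G p := by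
  rwa [show G = F from funext h]

theorem IsPrincipalPoly.add {F G : ℂ → ℂ} {p q : ℂ[X]} (hF : IsPrincipalPoly F p)
    (hG : IsPrincipalPoly G q) : IsPrincipalPoly (fun ζ => F ζ + G ζ) (p + q) := by
  obtain ⟨hp, f, hf, hpf⟩ := hF
  obtain ⟨hq, g, hg, hqg⟩ := hG
  refine ⟨by simp [hp, hq], fun ζ => f ζ + g ζ, hf.add hg, ?_⟩
  filter_upwards [hpf, hqg] with ζ h1 h2
  rw [h1, h2, Polynomial.eval_add]
  ring

theorem IsPrincipalPoly.const_mul {F : ℂ → ℂ} {p : ℂ[X]} (hF : IsPrincipalPoly F p) (z : ℂ) :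
    IsPrincipalPoly (fun ζ => z * F ζ) (Polynomial.C z * p) := by
  obtain ⟨hp, f, hf, hpf⟩ := hF
  refine ⟨by simp [hp], fun ζ => z * f ζ, analyticAt_const.mul hf, ?_⟩
  filter_upwards [hpf] with ζ h1
  rw [h1, Polynomial.eval_mul, Polynomial.eval_C]
  ring

theorem isPrincipalPoly_zero : IsPrincipalPoly (fun _ => 0) 0 :=
  ⟨by simp, fun _ => 0, analyticAt_const, by simp⟩

theorem IsPrincipalPoly.sum {ι : Type*} (s : Finset ι) {F : ι → ℂ → ℂ} {p : ι → ℂ[X]}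
    (h : ∀ i ∈ s, IsPrincipalPoly (F i) (p i)) :
    IsPrincipalPoly (fun ζ => ∑ i ∈ s, F i ζ) (∑ i ∈ s, p i) := by
  classical
  induction s using Finset.induction_on with
  | empty => simpa using isPrincipalPoly_zero
  | insert i s hi ih =>
    simp only [Finset.sum_insert hi]
    exact (h i (Finset.mem_insert_self i s)).add
      (ih fun j hj => h j (Finset.mem_insert_of_mem hj))

theorem IsPrincipalPoly.principalPoly_eq {F : ℂ → ℂ} {p : ℂ[X]} (hF : IsPrincipalPoly F p) :
    principalPoly F = p := by
  have h : ∃ p, IsPrincipalPoly F p := ⟨p, hF⟩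
  rw [principalPoly, dif_pos h]
  exact h.choose_spec.unique hF

/-- The regular part of a function meromorphic at `0` has a limit at `0`. -/
theorem exists_tendsto_regularPart {F : ℂ → ℂ} (hF : MeromorphicAt F 0) :
    ∃ z, Tendsto (regularPart F) (𝓝[≠] 0) (𝓝 z) := by
  obtain ⟨-, g, hg, h⟩ := isPrincipalPoly_principalPoly hF
  refine ⟨g 0, (hg.continuousAt.tendsto.mono_left nhdsWithin_le_nhds).congr' ?_⟩
  filter_upwards [h] with ζ h1
  rw [regularPart, h1, principalPart, add_sub_cancel_left]

/-- A function meromorphic at `0` that has a finite limit there has no principal part. -/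
theorem isPrincipalPoly_zero_of_tendsto {F : ℂ → ℂ} (hF : MeromorphicAt F 0) {z : ℂ}
    (hz : Tendsto F (𝓝[≠] 0) (𝓝 z)) : IsPrincipalPoly F 0 := by
  have hp := isPrincipalPoly_principalPoly hF
  obtain ⟨w, hw⟩ := exists_tendsto_regularPart hF
  have hlim : Tendsto (fun ζ : ℂ => (principalPoly F).eval ζ⁻¹) (𝓝[≠] 0) (𝓝 (z - w)) := by
    refine (hz.sub hw).congr fun ζ => ?_
    rw [regularPart, principalPart, sub_sub_cancel]
  have h0 : principalPoly F = 0 := by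
    by_contra hne
    have hdeg : 0 < (principalPoly F).degree := by
      by_contra hd
      have h1 := Polynomial.eq_C_of_degree_le_zero (not_lt.mp hd)
      rw [hp.1, Polynomial.C_0] at h1
      exact hne h1
    exact not_tendsto_nhds_of_tendsto_atTop (Polynomial.tendsto_norm_atTop _ hdeg
      (tendsto_norm_inv_nhdsNE_zero_atTop (α := ℂ))) _ hlim.norm
  rwa [h0] at hp

end MinSub
end

theorem mainTheorem1 (n : ℕ) (t₀ : 𝓓'(MinSub.punctured n, ℂ))
    (hsd : MinSub.sdPunctured t₀ < ⊤)
    (Ω : Set ℂ) (t : ℂ → 𝓓'((⊤ : Opens (MinSub.Rn n)), ℂ))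
    (ht : MinSub.IsAnalyticRegularization t₀ Ω t) :
    (∃ tMS : 𝓓'((⊤ : Opens (MinSub.Rn n)), ℂ),
      (∀ f : 𝓓((⊤ : Opens (MinSub.Rn n)), ℝ),
        Tendsto (MinSub.regularPart fun ζ => t ζ f) (𝓝[≠] 0) (𝓝 (tMS f))) ∧
      MinSub.IsExtension tMS t₀ ∧
      MinSub.sdWhole tMS = MinSub.sdPunctured t₀) ∧
    (∃ c : (Fin n → ℕ) →₀ ℂ[X],
      (∀ α ∈ c.support, MinSub.OrderLE α (MinSub.divDegree t₀) ∧ (c α).coeff 0 = 0) ∧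
      ∀ ζ : ℂ, ζ ≠ 0 → ∀ f : 𝓓((⊤ : Opens (MinSub.Rn n)), ℝ),
        MinSub.principalPart (fun z => t z f) ζ =
          (∑ α ∈ c.support, (c α).eval ζ⁻¹ • MinSub.deltaDeriv α) f) := by
  classical
  open MinSub in
  obtain ⟨m, hl⟩ := exists_isOrderBound (divDegree_lt_top hsd)
  obtain ⟨T, hText, hTw, hTpow⟩ := exists_flat_extension t₀ hl
  have hlim : ∀ g ∈ flatSubmodule n (divDegree t₀),
      Tendsto (fun ζ => t ζ g) (𝓝[≠] 0) (𝓝 (T g)) := fun g hg =>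
    ht.tendsto _ (isFlatExtension_restrict T hText hTpow) ⟨g, hg⟩
  -- The principal parts at the dual test functions determine all principal parts.
  let P : (Fin n → ℕ) → ℂ[X] := fun α => principalPoly fun ζ => t ζ (dualJet α)
  have hP : ∀ α, IsPrincipalPoly (fun ζ => t ζ (dualJet α)) (P α) := fun α =>
    isPrincipalPoly_principalPoly (ht.meromorphicAt _)
  have hdecomp : ∀ ζ f, t ζ f = t ζ (flatProj n m f) +
      ∑ α ∈ multiIndices n m, (jetCLM α f : ℂ) * t ζ (dualJet α) := by
    intro ζ f
    conv_lhs => rw [← flatProj_add_sum m f]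
    rw [map_add, map_sum]
    simp only [map_smul, Complex.real_smul]
  have hpp : ∀ f, principalPoly (fun ζ => t ζ f) =
      ∑ α ∈ multiIndices n m, Polynomial.C (jetCLM α f : ℂ) * P α := by
    intro f
    refine IsPrincipalPoly.principalPoly_eq (IsPrincipalPoly.congr ?_ fun ζ => hdecomp ζ f)
    have h0 := isPrincipalPoly_zero_of_tendsto (ht.meromorphicAt _)
      (hlim _ (flatProj_mem hl f))
    have := h0.add (IsPrincipalPoly.sum (multiIndices n m) fun α _ =>
      (hP α).const_mul (jetCLM α f : ℂ))
    rwa [zero_add] at this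
  choose z hz using fun α => exists_tendsto_regularPart (ht.meromorphicAt (dualJet α))
  have hsign : ∀ (α : Fin n → ℕ) (f : 𝓓((⊤ : Opens (Rn n)), ℝ)),
      (jetCLM α f : ℂ) = (-1) ^ (∑ a, α a) * deltaDeriv α f := by
    intro α f
    rw [deltaDeriv_apply, ← mul_assoc, ← mul_pow]
    simp
  refine ⟨?_, ?_⟩
  · let S : 𝓓((⊤ : Opens (Rn n)), ℝ) →L[ℝ] ℂ :=
      T + ∑ α ∈ multiIndices n m, (jetCLM α).smulRight (z α)
    have hS : ∀ f, S f = T f + ∑ α ∈ multiIndices n m, (jetCLM α f : ℂ) * z α := by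
      intro f
      simp [S]
    have hSflat : ∀ g ∈ flatSubmodule n (divDegree t₀), S g = T g := by
      intro g hg
      rw [hS, Finset.sum_eq_zero, add_zero]
      intro α hα
      rw [mem_flatSubmodule.1 hg α (hl.orderLE_iff.2 hα), Complex.ofReal_zero, zero_mul]
    have hext : IsExtension S t₀ := fun f =>
      (hSflat _ (incl_mem_flat _ f)).trans (hText f)
    refine ⟨S, fun f => ?_, hext, sdWhole_eq_of_isPowerBounded hsd S hext fun g hg δ hδ => ?_⟩
    · have hT : T (flatProj n m f) = T f := by
        rw [flatProj_apply, map_sub, map_sum, Finset.sum_eq_zero, sub_zero]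
        intro α hα
        rw [map_smul, hTw α hα, smul_zero]
      have hsum : Tendsto (fun ζ => t ζ (flatProj n m f) + ∑ α ∈ multiIndices n m,
          (jetCLM α f : ℂ) * regularPart (fun ζ => t ζ (dualJet α)) ζ) (𝓝[≠] 0) (𝓝 (S f)) := by
        rw [hS, ← hT]
        exact (hlim _ (flatProj_mem hl f)).add
          (tendsto_finsetSum _ fun α _ => (hz α).const_mul _)
      refine hsum.congr fun ζ => ?_
      have hr : regularPart (fun ζ => t ζ f) ζ =
          t ζ f - (principalPoly fun ζ => t ζ f).eval ζ⁻¹ := rfl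
      rw [hr, hpp, hdecomp ζ f]
      simp only [regularPart, principalPart, Polynomial.eval_finsetSum,
        Polynomial.eval_mul, Polynomial.eval_C, mul_sub, Finset.sum_sub_distrib, P]
      ring
    · obtain ⟨C, hC⟩ := hTpow g hg δ hδ
      refine ⟨C, fun c h0 h1 => ?_⟩
      have h := hSflat _ (dilate_mem_flat c hg)
      exact (congrArg norm h).trans_le (hC c h0 h1)
  · -- The sign comes from `⟨∂^α δ, f⟩ = (-1)^|α| (∂^α f)(0)`.
    obtain ⟨c, hsub, hcα⟩ : ∃ c : (Fin n → ℕ) →₀ ℂ[X], c.support ⊆ multiIndices n m ∧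
        ∀ α ∈ multiIndices n m, c α = Polynomial.C ((-1) ^ (∑ a, α a)) * P α :=
      ⟨Finsupp.onFinset (multiIndices n m)
        (fun α => if α ∈ multiIndices n m then Polynomial.C ((-1) ^ (∑ a, α a)) * P α else 0)
        (fun α h => by by_contra hα; simp [hα] at h), Finsupp.support_onFinset_subset,
        fun α hα => by rw [Finsupp.onFinset_apply, if_pos hα]⟩
    refine ⟨c, fun α hα => ⟨hl.orderLE_iff.2 (hsub hα), ?_⟩, fun ζ _ f => ?_⟩
    · rw [hcα α (hsub hα), Polynomial.coeff_C_mul, (hP α).1, mul_zero]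
    · rw [principalPart, hpp, Polynomial.eval_finsetSum]
      rw [Finset.sum_subset hsub fun α _ hα => by
        rw [Finsupp.notMem_support_iff.1 hα, Polynomial.eval_zero]
        ext g
        exact zero_mul _]
      rw [FunLike.coe_sum, Finset.sum_apply]
      refine Finset.sum_congr rfl fun α hα => ?_
      change _ = (c α).eval ζ⁻¹ * deltaDeriv α f
      rw [hcα α hα, Polynomial.eval_mul, Polynomial.eval_mul, Polynomial.eval_C,
        Polynomial.eval_C, hsign]
      ring
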